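/- Let $n\ge 3$. For real $x_{i,j}$ ($1\le i<j\le n$) and $y_1,\dots,y_{n-1}>0$ let $$z=\begin{pmatrix}1&x_{1,2}&\cdots&x_{1,n}\\&1&\cdots&x_{2,n}\\&&\ddots&\vdots\\&&&1\end{pmatrix}\operatorname{diag}(y_1y_2\cdots y_{n-1},\;y_1\cdots y_{n-2},\;\dots,\;y_1,\;1)$$ be a point, in Iwasawa coordinates, of $X_n=GL_n(\mathbb R)/(O_n(\mathbb R)\cdot\mathbb R^{*})$. For $k\ge 2$ let $P_{(k-1,1)}(\mathbb Z)$ be the group of matrices in $SL_k(\mathbb Z)$ with bottom row $(0,\dots,0,1)$, and for $w\in X_k$ let $E_{(k-1,1)}(w,s,1)$ be the meromorphic continuation to $s\in\mathbb C$ of $$\sum_{\gamma\in P_{(k-1,1)}(\mathbb Z)\backslash SL_k(\mathbb Z)}\det(\gamma w)^s\qquad(\mathrm{Re}\, s>1),$$ where $\det(w):=y_1^{k-1}y_2^{k-2}\cdots y_{k-1}$ in terms of the Iwasawa coordinates $y_1,\dots,y_{k-1}$ of $w$. Let $\mathfrak m_{n-1}(z)\in X_{n-1}$ be the class of the upper left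 $(n-1)\times(n-1)$ block of $z$, so that $\det(\mathfrak m_{n-1}(z))=y_2^{n-2}\cdots y_{n-1}$, and define $\ell=\ell(z)>0$ by $\ell^{-n}=y_1^{n-1}y_2^{n-2}\cdots y_{n-1}$. Put $\xi(s)=\pi^{-s/2}\Gamma(s/2)\zeta(s)$, $\sigma_\nu(m)=\sum_{c\mid m}c^\nu$, and let $K_\nu$ be the $K$-Bessel function. Let $s=a+bi$ with $a,b\in\mathbb R$, such that $s\neq 1$ and neither $\xi(ns)$ nor $\xi(ns-1)$ has a zero or a pole at $s$. Then $|E_{(n-1,1)}(z,s,1)|^2$ is integrable in $(x_{1,n},\dots,x_{n-1,n})$ over $(\mathbb Z\backslash\mathbb R)^{n-1}$, the double sum below converges absolutely, and $$\begin{aligned} &\int_{(\mathbb Z\backslash\mathbb R)^{n-1}}\left|E_{(n-1,1)}(z,s,1)\right|^2\prod_{h=1}^{n-1}dx_{h,n}\\ &=4\ell^{-2na}+\frac{|\xi(ns-1)|^2}{|\xi(ns)|^2}\left(y_1^{n-1}y_2^{n-2}\cdots y_{n-1}\right)^{\frac{2-2a}{n-1}}\left|E_{(n-2,1)}\!\left(\mathfrak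 m_{n-1}(z),\tfrac{ns-1}{n-1},1\right)\right|^2\\ &\quad+2\ell^{-\frac{n^2a-2na+n+in^2b}{n-1}}\frac{\xi(n\bar s-1)}{\xi(n\bar s)}E_{(n-2,1)}\!\left(\mathfrak m_{n-1}(z),\tfrac{n\bar s-1}{n-1},1\right)\\ &\quad+2\ell^{-\frac{n^2a-2na+n-in^2b}{n-1}}\frac{\xi(ns-1)}{\xi(ns)}E_{(n-2,1)}\!\left(\mathfrak m_{n-1}(z),\tfrac{ns-1}{n-1},1\right)\\ &\quad+\frac{16\,\ell^{-2na}}{|\xi(ns)|^2}\sum_{m=1}^\infty\ \sum_{\gamma\in P_{(n-2,1)}(\mathbb Z)\backslash SL_{n-1}(\mathbb Z)}m^{na-1}\sigma_{-na+1-inb}(m)\,\sigma_{-na+1+inb}(m)\\ &\qquad\times\Big[r(z)^{-na+1}K_{\frac{na-1}2+\frac{inb}2}\big(2\pi m\,r(z)\big)K_{\frac{na-1}2-\frac{inb}2}\big(2\pi m\,r(z)\big)\Big]\Big|_\gamma , \end{aligned}$$ where $r(z)=\ell(z)^{-\frac n{n-1}}\det(\mathfrak m_{n-1}(z))^{-\frac1{n-1}}$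 and $f(z)|_\gamma=f\!\left(\begin{pmatrix}\gamma&\\&1\end{pmatrix}z\right)$. -/

import Mathlib

open MeasureTheory Complex

noncomputable section

namespace DegenerateEisenstein

/-! Conventions.  `d` always stands for `(size) - 1`, so that the matrices of `GL_{d+1}` are indexed
by `Fin (d + 1)`.  Rows, columns and the coordinates `y₁, …, y_d` are numbered from `0` in the code:
`y j` is the coordinate `y_{j+1}` and `x i j` is the coordinate `x_{i+1,j+1}`. -/

/-- The matrix `x · y` in Iwasawa coordinates: `x` is upper triangular unipotent with the entries
`x i j` for `i < j` (the other entries of the argument `x` are ignored), and `y` is diagonal with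
diagonal `(y₁ y₂ ⋯ y_d, y₁ ⋯ y_{d-1}, …, y₁, 1)`. -/
def iwasawaMatrix {d : ℕ} (x : Matrix (Fin (d + 1)) (Fin (d + 1)) ℝ) (y : Fin d → ℝ) :
    Matrix (Fin (d + 1)) (Fin (d + 1)) ℝ :=
  Matrix.of (fun i j => if i = j then 1 else if i < j then x i j else 0) *
    Matrix.diagonal (fun i : Fin (d + 1) => ∏ j ∈ Finset.univ.filter
      (fun j : Fin d => (j : ℕ) + (i : ℕ) < d), y j)

/-- `(x, y)` are Iwasawa coordinates of the class of `g` in `GL_{d+1}(ℝ) / (O_{d+1}(ℝ) · ℝˣ)`. -/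
def IsIwasawa {d : ℕ} (g x : Matrix (Fin (d + 1)) (Fin (d + 1)) ℝ) (y : Fin d → ℝ) : Prop :=
  (∀ j, 0 < y j) ∧
    ∃ κ ∈ Matrix.orthogonalGroup (Fin (d + 1)) ℝ, ∃ r : ℝ, r ≠ 0 ∧ g = r • (iwasawaMatrix x y * κ)

open Classical in
/-- The Iwasawa coordinates `(y₁, …, y_d)` of an invertible matrix `g`; they are unique.
(The value for a singular `g` is irrelevant.) -/
def iwasawaY {d : ℕ} (g : Matrix (Fin (d + 1)) (Fin (d + 1)) ℝ) : Fin d → ℝ :=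
  if h : ∃ y, ∃ x, IsIwasawa g x y then h.choose else 0

/-- The determinant `y₁^d y₂^{d-1} ⋯ y_d` of the diagonal part of `g` in Iwasawa form. -/
def detY {d : ℕ} (g : Matrix (Fin (d + 1)) (Fin (d + 1)) ℝ) : ℝ :=
  ∏ j : Fin d, iwasawaY g j ^ (d - (j : ℕ))

/-- The integral maximal parabolic subgroup `P_{(d,1)}(ℤ)` of `SL_{d+1}(ℤ)`: the matrices whose
bottom row is `(0, …, 0, 1)`. -/
def parabolic (d : ℕ) : Subgroup (Matrix.SpecialLinearGroup (Fin (d + 1)) ℤ) where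
  carrier := {γ | ∀ j, γ (Fin.last d) j = if j = Fin.last d then 1 else 0}
  one_mem' := by
    intro j
    simp [Matrix.one_apply, eq_comm]
  mul_mem' := by
    intro a b ha hb j
    simp only [Set.mem_ofPred_eq] at ha hb
    simp [Matrix.mul_apply, ha, hb]
  inv_mem' := by
    intro a ha j
    simp only [Set.mem_ofPred_eq] at ha
    have h : (a * a⁻¹) (Fin.last d) j = (1 : Matrix _ _ ℤ) (Fin.last d) j := by
      rw [mul_inv_cancel]; rfl
    rw [Matrix.SpecialLinearGroup.coe_mul, Matrix.mul_apply] at h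
    simpa [ha, Matrix.one_apply, eq_comm] using h

/-- The coset space `P_{(d,1)}(ℤ) \ SL_{d+1}(ℤ)` (classes `P γ`). -/
abbrev Cosets (d : ℕ) : Type := Quotient (QuotientGroup.rightRel (parabolic d))

/-- A representative in `SL_{d+1}(ℤ)` of a coset, as a real matrix.  All functions summed over cosets
below are invariant under left multiplication by `P_{(d,1)}(ℤ)`. -/
def Cosets.rep {d : ℕ} (q : Cosets d) : Matrix (Fin (d + 1)) (Fin (d + 1)) ℝ :=
  (q.out : Matrix (Fin (d + 1)) (Fin (d + 1)) ℤ).map (Int.cast : ℤ → ℝ)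

/-- The series `∑_{γ ∈ P_{(d,1)}(ℤ) \ SL_{d+1}(ℤ)} I_s(γ z, P_{(d,1)})`, where
`I_s(z, P_{(d,1)}) = (y₁^d y₂^{d-1} ⋯ y_d)^s`.  It converges absolutely for `Re s > 1`. -/
def eisensteinSeries (d : ℕ) (z : Matrix (Fin (d + 1)) (Fin (d + 1)) ℝ) (s : ℂ) : ℂ :=
  ∑' q : Cosets d, ((detY (q.rep * z) : ℝ) : ℂ) ^ s

/-- `F` is the meromorphic continuation to `ℂ` of the function `f` given on `Re s > 1`. The function
`F` is normalised so that it is analytic at each point which is not a pole and takes the value `0`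
at each pole; this makes `F` unique. -/
def IsMeromorphicContinuation (f F : ℂ → ℂ) : Prop :=
  MeromorphicNFOn F Set.univ ∧ ∀ s : ℂ, 1 < s.re → F s = f s

open Classical in
/-- The meromorphic continuation of `f` from `Re s > 1` to `ℂ` (`f` itself if there is none). -/
def meromorphicContinuation (f : ℂ → ℂ) : ℂ → ℂ :=
  if h : ∃ F, IsMeromorphicContinuation f F then h.choose else f

/-- The degenerate Eisenstein series `E_{(d,1)}(z, s, 1)` on `GL_{d+1}`, for all `s ∈ ℂ`. -/
def E (d : ℕ) (z : Matrix (Fin (d + 1)) (Fin (d + 1)) ℝ) : ℂ → ℂ :=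
  meromorphicContinuation (eisensteinSeries d z)

/-- The projection `𝔪_{d+1}` of `P_{(d+1,1)}(ℝ)` to its upper left block of size `d + 1`. -/
def levi {d : ℕ} (z : Matrix (Fin (d + 2)) (Fin (d + 2)) ℝ) :
    Matrix (Fin (d + 1)) (Fin (d + 1)) ℝ :=
  z.submatrix Fin.castSucc Fin.castSucc

/-- The block diagonal matrix `diag(γ, 1)`. -/
def embed {d : ℕ} (γ : Matrix (Fin (d + 1)) (Fin (d + 1)) ℝ) :
    Matrix (Fin (d + 2)) (Fin (d + 2)) ℝ :=
  Matrix.of (Fin.snoc (α := fun _ => Fin (d + 2) → ℝ)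
    (fun i => Fin.snoc (α := fun _ => ℝ) (γ i) 0) (Fin.snoc (α := fun _ => ℝ) 0 1))

/-- The matrix `x` with the entries `x_{h,n}`, `1 ≤ h ≤ n - 1`, of its last column replaced by `t`
(here `n = d + 1`). -/
def setLastColumn {d : ℕ} (x : Matrix (Fin (d + 1)) (Fin (d + 1)) ℝ) (t : Fin d → ℝ) :
    Matrix (Fin (d + 1)) (Fin (d + 1)) ℝ :=
  x.updateCol (Fin.last d) (Fin.snoc (α := fun _ => ℝ) t 1)

/-- `ℓ(z)`, defined by `ℓ^{-n} = y₁^{n-1} y₂^{n-2} ⋯ y_{n-1}` for `n = d + 1`. -/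
def ell {d : ℕ} (z : Matrix (Fin (d + 1)) (Fin (d + 1)) ℝ) : ℝ :=
  detY z ^ (-1 / ((d : ℝ) + 1))

/-- The completed zeta function `ξ(s) = π^{-s/2} Γ(s/2) ζ(s)`. -/
def xi (s : ℂ) : ℂ := completedRiemannZeta s

/-- The divisor function `σ_ν(m) = ∑_{c ∣ m} c^ν`. -/
def sigma (ν : ℂ) (m : ℕ) : ℂ := ∑ c ∈ m.divisors, (c : ℂ) ^ ν

/-- The `K`-Bessel function `K_ν(r) = ½ ∫_0^∞ e^{-r (t + 1/t) / 2} t^ν dt/t` for `r > 0`. -/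
def besselK (ν : ℂ) (r : ℝ) : ℂ :=
  1 / 2 * ∫ t in Set.Ioi (0 : ℝ), ((Real.exp (-r * (t + t⁻¹) / 2) : ℝ) : ℂ) * (t : ℂ) ^ (ν - 1)

/-- The quantity `ℓ^{-n/(n-1)} / det(𝔪_{n-1}(z))^{1/(n-1)}` for `n = d + 2`, where
`det(𝔪_{n-1}(z)) = y₂^{n-2} ⋯ y_{n-1}` is the determinant of the diagonal part of `𝔪_{n-1}(z)` in
Iwasawa form. -/
def radius {d : ℕ} (z : Matrix (Fin (d + 2)) (Fin (d + 2)) ℝ) : ℝ :=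
  ell z ^ (-((d : ℝ) + 2) / ((d : ℝ) + 1)) / detY (levi z) ^ (1 / ((d : ℝ) + 1))

/-- The function of `z` which is summed over `m` and over `γ` in the last term of the formula, for
`n = d + 2` and `s = a + b i`. -/
def besselTerm {d : ℕ} (a b : ℝ) (m : ℕ) (z : Matrix (Fin (d + 2)) (Fin (d + 2)) ℝ) : ℂ :=
  let n : ℂ := (d : ℂ) + 2
  (m : ℂ) ^ (n * a - 1) * sigma (-n * a + 1 - I * n * b) m * sigma (-n * a + 1 + I * n * b) m *
    (radius z : ℂ) ^ (-n * a + 1) *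
    besselK ((n * a - 1) / 2 + I * n * b / 2) (2 * Real.pi * m * radius z) *
    besselK ((n * a - 1) / 2 - I * n * b / 2) (2 * Real.pi * m * radius z)

end DegenerateEisenstein

end

noncomputable section

namespace DegenerateEisenstein

/-! ### Iwasawa decomposition and the determinant of the diagonal part -/

section Iwasawa

/-! Only bottom rows matter: if g = r · (xy) · κ, then det(xy) = |det g| / ‖bottom row of g‖^n
(`detY_eq`). For n ≥ 2 every nonzero integral vector is, in exactly one way, a positive multiple of
a bottom row of SL_n(ℤ) (`vectorEquiv`). Hence, for Re s > 1, ξ(ns) E(z,s) is |det z|^s times the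
Mellin transform at ns/2 of θ_z(t) - 1, where θ_z is the theta series of the lattice ℤ^n z
(`eisensteinSeries_mul_xi`).

The last row of z is (0,…,0,1), so Poisson summation in the last lattice coordinate alone splits θ_z
into three parts: a one-dimensional theta series; t^{-1/2}(θ_M(t) - 1) for the Levi block M; and
`remainder`, which decays rapidly at 0 and at ∞. Their Mellin transforms are 2ξ(ns), the completed
Eisenstein series of M at a shifted argument, and an entire function which is an absolutely
convergent sum of K-Bessel functions times characters of the last column. The first two do not
involve the last column and form the constant term. The third has frequencies m · row(γ), with
σ_ν(m) arising from the factorisations of m (`IsAffine.hasSum_besselCoeff`).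

All this must be transported to arbitrary s. Since `E` is a chosen meromorphic continuation, its
value at s is read off from any explicit meromorphic function that agrees with the series for Re s >
1 and is analytic there and at s (`meromorphicContinuation_eq`). The only continuation to be
constructed is that of the Mellin transform of θ_M - 1; it comes from the expansion θ_M(t) = C
t^{-k/2} + O(t^N) at 0 (`theta_asymptotic`), with k the size of M.

The frequencies m · row(γ) are nonzero and pairwise distinct, so Parseval
(`hasSum_norm_sq_of_hasSum_character`) gives the mean square as |constant term|² plus the sum of the
|Bessel coefficient|². Expanding the first produces four terms; the second is the double sum. -/

theorem det_iwasawaMatrix {d : ℕ} (x : Matrix (Fin (d + 1)) (Fin (d + 1)) ℝ) (y : Fin d → ℝ) :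
    (iwasawaMatrix x y).det = ∏ j : Fin d, y j ^ (d - (j : ℕ)) := by
  rw [iwasawaMatrix, Matrix.det_mul, Matrix.det_diagonal, Matrix.det_of_isUpperTriangular]
  · simp only [Matrix.of_apply, if_true, Finset.prod_const_one, one_mul]
    rw [Finset.prod_comm' (t' := Finset.univ)
      (s' := fun j : Fin d => Finset.univ.filter fun i : Fin (d + 1) => (j : ℕ) + (i : ℕ) < d)
      (by simp)]
    refine Finset.prod_congr rfl fun j _ => ?_
    rw [Finset.prod_const]
    congr 1
    have : (Finset.univ.filter fun i : Fin (d + 1) => (j : ℕ) + (i : ℕ) < d) =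
        Finset.univ.filter fun i : Fin (d + 1) => (i : ℕ) < d - (j : ℕ) := by
      ext i; simp only [Finset.mem_filter, Finset.mem_univ, true_and]; omega
    rw [this, Fin.card_filter_val_lt]
    omega
  · intro i j hij
    simp only [id] at hij
    simp [hij.ne', hij.not_gt]

theorem iwasawaMatrix_last {d : ℕ} (x : Matrix (Fin (d + 1)) (Fin (d + 1)) ℝ) (y : Fin d → ℝ)
    (j : Fin (d + 1)) :
    iwasawaMatrix x y (Fin.last d) j = if j = Fin.last d then 1 else 0 := by
  rw [iwasawaMatrix, Matrix.mul_diagonal, Matrix.of_apply]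
  by_cases h : j = Fin.last d
  · subst h; simp
  · rw [if_neg (Ne.symm h), if_neg (Fin.le_last j).not_gt, if_neg h, zero_mul]

/-- The product telescopes. It recovers the coordinates `y` from the diagonal of an upper triangular
matrix scaled to have last entry 1. -/
theorem prod_ratio_filter {d : ℕ} (f : Fin (d + 1) → ℝ) (hf : ∀ i, f i ≠ 0) (i : Fin (d + 1)) :
    ∏ j ∈ Finset.univ.filter (fun j : Fin d => (j : ℕ) + (i : ℕ) < d),
      f (Fin.rev j).castSucc / f (Fin.rev j).succ = f i / f (Fin.last d) := by
  induction i using Fin.reverseInduction with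
  | last => simp [Finset.filter_false, div_self (hf _)]
  | cast k ih =>
    have : (Finset.univ.filter fun j : Fin d => (j : ℕ) + (k.castSucc : ℕ) < d) =
        insert (Fin.rev k) (Finset.univ.filter fun j : Fin d => (j : ℕ) + (k.succ : ℕ) < d) := by
      ext j
      simp only [Finset.mem_filter, Finset.mem_univ, true_and, Finset.mem_insert, Fin.ext_iff,
        Fin.val_rev, Fin.val_castSucc, Fin.val_succ]
      omega
    rw [this, Finset.prod_insert, ih, Fin.rev_rev]
    · field_simp [hf]
    · simp only [Finset.mem_filter, Finset.mem_univ, true_and, Fin.val_rev, Fin.val_succ]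
      omega

/-- Gram–Schmidt by way of the LDL decomposition of g⁻ᵀg⁻¹: with T the lower triangular factor, X =
g⁻¹Tᵀ has orthogonal columns, and gX = Tᵀ is upper triangular. Normalising the columns of X gives
the orthogonal factor. -/
theorem exists_upperTriangular_mul_orthogonal {d : ℕ} (g : Matrix (Fin (d + 1)) (Fin (d + 1)) ℝ)
    (hg : g.det ≠ 0) :
    ∃ U : Matrix (Fin (d + 1)) (Fin (d + 1)) ℝ, ∃ κ ∈ Matrix.orthogonalGroup (Fin (d + 1)) ℝ,
      (∀ i j, j < i → U i j = 0) ∧ (∀ i, 0 < U i i) ∧ g = U * κ := by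
  classical
  have hgu : IsUnit g.det := isUnit_iff_ne_zero.2 hg
  have hgiu : IsUnit g⁻¹ := (Matrix.isUnit_nonsing_inv_iff).2 ((Matrix.isUnit_iff_isUnit_det g).2 hgu)
  have hS : (Matrix.transpose g⁻¹ * g⁻¹).PosDef := by
    have := Matrix.PosDef.conjTranspose_mul_self g⁻¹
      (Matrix.mulVec_injective_of_isUnit hgiu)
    rwa [Matrix.conjTranspose_eq_transpose_of_trivial] at this
  set T := LDL.lowerInv hS with hT
  have hTdet : IsUnit T.det := Matrix.isUnit_det_of_invertible T
  have hD := LDL.diag_eq_lowerInv_conj hS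
  rw [← hT, Matrix.conjTranspose_eq_transpose_of_trivial, LDL.diag] at hD
  set e := LDL.diagEntries hS
  set X := g⁻¹ * T.transpose with hX
  have hXX : X.transpose * X = Matrix.diagonal e := by
    rw [hD, hX, Matrix.transpose_mul, Matrix.transpose_transpose]
    simp only [Matrix.mul_assoc]
  have hXdet : X.det ≠ 0 := by
    rw [hX, Matrix.det_mul, Matrix.det_transpose]
    exact mul_ne_zero ((Matrix.isUnit_iff_isUnit_det _).1 hgiu).ne_zero hTdet.ne_zero
  have he : ∀ i, 0 < e i := by
    intro i
    have h1 : 0 ≤ e i := by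
      have := congrFun (congrFun hXX i) i
      rw [Matrix.diagonal_apply_eq, Matrix.mul_apply] at this
      rw [← this]
      exact Finset.sum_nonneg fun j _ => by
        rw [Matrix.transpose_apply]; exact mul_self_nonneg _
    refine lt_of_le_of_ne h1 fun h => ?_
    have h2 : (Matrix.diagonal e).det = 0 := by
      rw [Matrix.det_diagonal]
      exact Finset.prod_eq_zero (Finset.mem_univ i) h.symm
    rw [← hXX, Matrix.det_mul, Matrix.det_transpose] at h2
    exact hXdet (mul_self_eq_zero.1 h2)
  have htri : ∀ i j, i < j → T i j = 0 := fun i j h => LDL.lowerInv_triangular hS h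
  have hTii : ∀ i, T i i ≠ 0 := by
    have : T.det = ∏ i, T i i := Matrix.det_of_isLowerTriangular T fun i j h => htri i j h
    intro i h
    exact hTdet.ne_zero (this.trans (Finset.prod_eq_zero (Finset.mem_univ i) h))
  -- The square root makes the columns of X unit vectors; the sign makes the diagonal of the
  -- triangular factor positive.
  set c : Fin (d + 1) → ℝ := fun i => SignType.sign (T i i) / √(e i) with hc
  have hc0 : ∀ i, c i ^ 2 * e i = 1 := by
    intro i
    have h1 : ((SignType.sign (T i i) : ℝ)) ^ 2 = 1 := by
      rcases lt_or_gt_of_ne (hTii i) with h | h <;> simp [h]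
    rw [hc]
    simp only [div_pow, h1, Real.sq_sqrt (he i).le]
    field_simp [(he i).ne']
  set k := X * Matrix.diagonal c with hk
  have hkO : k.transpose * k = 1 := by
    rw [hk, Matrix.transpose_mul, Matrix.diagonal_transpose, Matrix.mul_assoc,
      ← Matrix.mul_assoc X.transpose, hXX, Matrix.diagonal_mul_diagonal,
      Matrix.diagonal_mul_diagonal, ← Matrix.diagonal_one]
    congr 1
    ext i
    rw [← hc0 i]; ring
  refine ⟨T.transpose * Matrix.diagonal c, k.transpose, ?_, ?_, ?_, ?_⟩
  · rw [Matrix.mem_orthogonalGroup_iff, Matrix.transpose_transpose]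
    exact hkO
  · intro i j h
    rw [Matrix.mul_diagonal, Matrix.transpose_apply, htri j i h, zero_mul]
  · intro i
    rw [Matrix.mul_diagonal, Matrix.transpose_apply, hc]
    have : 0 < √(e i) := Real.sqrt_pos.2 (he i)
    rw [← mul_div_assoc]
    refine div_pos ?_ this
    rw [mul_comm, sign_mul_self]
    exact abs_pos.2 (hTii i)
  · have h1 : g * k = T.transpose * Matrix.diagonal c := by
      rw [hk, hX, ← Matrix.mul_assoc, ← Matrix.mul_assoc, Matrix.mul_nonsing_inv _ hgu,
        Matrix.one_mul]
    rw [← h1, Matrix.mul_assoc, mul_eq_one_comm.1 hkO, Matrix.mul_one]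

theorem exists_isIwasawa {d : ℕ} (g : Matrix (Fin (d + 1)) (Fin (d + 1)) ℝ) (hg : g.det ≠ 0) :
    ∃ y, ∃ x, IsIwasawa g x y := by
  obtain ⟨U, κ, hκ, htri, hpos, rfl⟩ := exists_upperTriangular_mul_orthogonal g hg
  refine ⟨fun j => U (Fin.rev j).castSucc (Fin.rev j).castSucc / U (Fin.rev j).succ (Fin.rev j).succ,
    fun i j => U i j / U j j, fun j => div_pos (hpos _) (hpos _), κ, hκ,
    U (Fin.last d) (Fin.last d), (hpos _).ne', ?_⟩
  rw [← Matrix.smul_mul]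
  congr 1
  ext i j
  rw [Matrix.smul_apply]
  unfold iwasawaMatrix
  rw [Matrix.mul_diagonal, Matrix.of_apply,
    prod_ratio_filter (fun i => U i i) (fun i => (hpos i).ne') j, smul_eq_mul]
  have h1 := (hpos j).ne'
  have h2 := (hpos (Fin.last d)).ne'
  split_ifs with h h'
  · subst h; field_simp
  · field_simp
  · rw [htri i j (lt_of_le_of_ne (not_lt.1 h') (Ne.symm h)), zero_mul, mul_zero]

theorem iwasawaY_spec {d : ℕ} (g : Matrix (Fin (d + 1)) (Fin (d + 1)) ℝ) (hg : g.det ≠ 0) :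
    ∃ x, IsIwasawa g x (iwasawaY g) := by
  have h := exists_isIwasawa g hg
  rw [iwasawaY, dif_pos h]
  exact h.choose_spec

/-- The last row of the Iwasawa matrix is a unit vector, so the last row of g = r · (xy) · κ has
length |r|, while |det g| = |r|^{d+1} det(xy). The formula also shows that the choice made in
`iwasawaY` does not affect `detY`. -/
theorem detY_eq {d : ℕ} (g : Matrix (Fin (d + 1)) (Fin (d + 1)) ℝ) (hg : g.det ≠ 0) :
    detY g = |g.det| / √(∑ j, g (Fin.last d) j ^ 2) ^ (d + 1) := by
  obtain ⟨x, hy, κ, hκ, r, hr, hgr⟩ := iwasawaY_spec g hg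
  have hκ' : κ * κ.transpose = 1 := (Matrix.mem_orthogonalGroup_iff _ _).1 hκ
  have hdet : |κ.det| = 1 := by
    have := congrArg Matrix.det hκ'
    rw [Matrix.det_mul, Matrix.det_transpose, Matrix.det_one] at this
    rcases mul_self_eq_one_iff.1 this with h | h <;> simp [h]
  have hrow : ∀ j, g (Fin.last d) j = r * κ (Fin.last d) j := by
    intro j
    rw [hgr, Matrix.smul_apply, Matrix.mul_apply, smul_eq_mul]
    simp [iwasawaMatrix_last]
  have hsum : ∑ j, g (Fin.last d) j ^ 2 = r ^ 2 := by
    simp only [hrow, mul_pow, ← Finset.mul_sum]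
    have := congrFun (congrFun hκ' (Fin.last d)) (Fin.last d)
    rw [Matrix.mul_apply, Matrix.one_apply_eq] at this
    simp only [Matrix.transpose_apply, ← pow_two] at this
    rw [this, mul_one]
  rw [hsum, Real.sqrt_sq_eq_abs]
  have hD : 0 < ∏ j : Fin d, iwasawaY g j ^ (d - (j : ℕ)) :=
    Finset.prod_pos fun j _ => pow_pos (hy j) _
  conv_rhs => rw [hgr]
  rw [Matrix.det_smul, Matrix.det_mul, det_iwasawaMatrix, abs_mul, abs_mul, hdet, mul_one,
    abs_pow, Fintype.card_fin, abs_of_pos hD, mul_div_cancel_left₀ _ (pow_ne_zero _ (abs_ne_zero.2 hr))]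
  rfl

end Iwasawa

/-! ### Integral vectors as multiples of bottom rows of SL -/

section PrimitiveVectors

open Matrix

theorem vecMul_transvection {n : Type*} [Fintype n] [DecidableEq n] (v : n → ℤ) (i j k : n) (c : ℤ) :
    (v ᵥ* transvection i j c) k = v k + if k = j then c * v i else 0 := by
  rw [transvection, vecMul_add, vecMul_one, Pi.add_apply]
  congr 1
  simp only [vecMul, dotProduct, single_apply]
  rw [Finset.sum_eq_single i]
  · by_cases h : k = j
    · simp [h, mul_comm]
    · simp [h, Ne.symm h]
  · intro b _ hb; simp [Ne.symm hb]
  · simp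

/-- `v` is an integral multiple of the bottom row of a matrix in `SL_{d+1}(ℤ)`. -/
def IsMulBottomRow {d : ℕ} (v : Fin (d + 1) → ℤ) : Prop :=
  ∃ γ : Matrix.SpecialLinearGroup (Fin (d + 1)) ℤ, ∃ m : ℤ, v = m • γ (Fin.last d)

theorem IsMulBottomRow.of_vecMul {d : ℕ} {v : Fin (d + 1) → ℤ}
    {T : Matrix.SpecialLinearGroup (Fin (d + 1)) ℤ} (h : IsMulBottomRow (v ᵥ* (T : Matrix (Fin (d + 1)) (Fin (d + 1)) ℤ))) :
    IsMulBottomRow v := by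
  obtain ⟨γ, m, hm⟩ := h
  refine ⟨γ * T⁻¹, m, ?_⟩
  have h1 : v = (v ᵥ* (T : Matrix (Fin (d + 1)) (Fin (d + 1)) ℤ)) ᵥ* ((T⁻¹ : Matrix.SpecialLinearGroup (Fin (d + 1)) ℤ) : Matrix _ _ ℤ) := by
    rw [vecMul_vecMul, ← Matrix.SpecialLinearGroup.coe_mul, mul_inv_cancel, Matrix.SpecialLinearGroup.coe_one,
      vecMul_one]
  rw [h1, hm, smul_vecMul]
  rfl

theorem IsMulBottomRow.of_transvection {d : ℕ} {v : Fin (d + 1) → ℤ} {i j : Fin (d + 1)}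
    (hij : i ≠ j) (c : ℤ) (h : IsMulBottomRow fun k => v k + if k = j then c * v i else 0) :
    IsMulBottomRow v := by
  refine IsMulBottomRow.of_vecMul (T := Matrix.SpecialLinearGroup.transvection hij c) ?_
  convert! h using 1
  ext k
  exact vecMul_transvection v i j k c

theorem isMulBottomRow_of_support {d : ℕ} {v : Fin (d + 1) → ℤ} (i : Fin (d + 1))
    (h : ∀ k, k ≠ i → v k = 0) : IsMulBottomRow v := by
  have hlast : ∀ v : Fin (d + 1) → ℤ, (∀ k, k ≠ Fin.last d → v k = 0) → IsMulBottomRow v := by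
    intro v hv
    refine ⟨1, v (Fin.last d), ?_⟩
    ext k
    by_cases hk : k = Fin.last d
    · simp [hk]
    · simp [hv k hk, Matrix.one_apply_ne (Ne.symm hk)]
  by_cases hi : i = Fin.last d
  · exact hlast v (by rwa [hi] at h)
  -- Copy the only possibly nonzero entry into the last place, then subtract it from its old place.
  · refine IsMulBottomRow.of_transvection hi 1 ?_
    refine IsMulBottomRow.of_transvection (Ne.symm hi) (-1) (hlast _ fun k hk => ?_)
    by_cases hki : k = i
    · subst hki; simp [hk, h _ (Ne.symm hk)]
    · simp [hk, hki, h k hki]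

/-- Euclidean algorithm: as long as two entries are nonzero, a transvection adding ± the smaller one
to the larger decreases the sum of the absolute values. -/
theorem isMulBottomRow {d : ℕ} (v : Fin (d + 1) → ℤ) : IsMulBottomRow v := by
  induction hN : ∑ i, (v i).natAbs using Nat.strong_induction_on generalizing v with
  | _ N ih =>
    by_cases hs : ∃ i j, i ≠ j ∧ v i ≠ 0 ∧ v j ≠ 0
    · obtain ⟨i, j, hij, hi, hj⟩ := hs
      wlog hle : (v i).natAbs ≤ (v j).natAbs generalizing i j
      · exact this j i hij.symm hj hi (le_of_not_ge hle)
      obtain ⟨c, hc⟩ : ∃ c : ℤ, (v j + c * v i).natAbs < (v j).natAbs := by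
        rcases le_total 0 (v i) with h1 | h1 <;> rcases le_total 0 (v j) with h2 | h2
        · exact ⟨-1, by omega⟩
        · exact ⟨1, by omega⟩
        · exact ⟨1, by omega⟩
        · exact ⟨-1, by omega⟩
      refine IsMulBottomRow.of_transvection hij c (ih _ ?_ _ rfl)
      rw [← hN]
      refine Finset.sum_lt_sum (fun k _ => ?_) ⟨j, Finset.mem_univ _, by simpa using hc⟩
      by_cases hk : k = j
      · subst hk; simpa using hc.le
      · simp [hk]
    · push Not at hs
      by_cases h0 : ∃ i, v i ≠ 0
      · obtain ⟨i, hi⟩ := h0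
        exact isMulBottomRow_of_support i fun k hk => hs i k (Ne.symm hk) hi
      · push Not at h0
        exact isMulBottomRow_of_support 0 fun k _ => h0 k

/-- Changing the sign of the first and last rows keeps the determinant 1. This needs two different
rows: in size 1 the vector -1 is not a bottom row. -/
theorem exists_neg_bottomRow {d : ℕ} (hd : 1 ≤ d) (γ : Matrix.SpecialLinearGroup (Fin (d + 1)) ℤ) :
    ∃ δ : Matrix.SpecialLinearGroup (Fin (d + 1)) ℤ, δ (Fin.last d) = -γ (Fin.last d) := by
  have h0 : (0 : Fin (d + 1)) ≠ Fin.last d := by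
    intro h; have := congrArg Fin.val h; simp at this; omega
  let e : Fin (d + 1) → ℤ := fun i =>
    (if i = 0 then -1 else 1) * (if i = Fin.last d then -1 else 1)
  have he : (diagonal e).det = 1 := by
    rw [det_diagonal, Finset.prod_mul_distrib]
    simp [Finset.prod_ite_eq']
  let D : Matrix.SpecialLinearGroup (Fin (d + 1)) ℤ := ⟨diagonal e, he⟩
  refine ⟨D * γ, ?_⟩
  ext j
  rw [Matrix.SpecialLinearGroup.coe_mul, show (D : Matrix (Fin (d + 1)) (Fin (d + 1)) ℤ) =
    diagonal e from rfl, diagonal_mul]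
  simp [e, h0.symm]

end PrimitiveVectors

/-! ### Cosets of the parabolic subgroup and their bottom rows -/

section Cosets

open Matrix

/-- The bottom row of the matrices in a coset. -/
def Cosets.row {d : ℕ} (q : Cosets d) : Fin (d + 1) → ℤ := q.out (Fin.last d)

theorem mem_parabolic_iff {d : ℕ} {γ : Matrix.SpecialLinearGroup (Fin (d + 1)) ℤ} :
    γ ∈ parabolic d ↔ ∀ j, γ (Fin.last d) j = if j = Fin.last d then 1 else 0 := Iff.rfl

theorem rightRel_parabolic_iff {d : ℕ} (γ δ : Matrix.SpecialLinearGroup (Fin (d + 1)) ℤ) :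
    (QuotientGroup.rightRel (parabolic d)) γ δ ↔ γ (Fin.last d) = δ (Fin.last d) := by
  rw [QuotientGroup.rightRel_apply, mem_parabolic_iff]
  have hone : ∀ j, (1 : Matrix.SpecialLinearGroup (Fin (d + 1)) ℤ) (Fin.last d) j =
      if j = Fin.last d then 1 else 0 := fun j => by
    simp [Matrix.one_apply, eq_comm]
  constructor
  · intro h
    have h1 : δ = (δ * γ⁻¹) * γ := by group
    ext j
    conv_rhs => rw [h1]
    rw [Matrix.SpecialLinearGroup.coe_mul, Matrix.mul_apply]
    simp [h]
  · intro h j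
    rw [← hone, ← mul_inv_cancel γ, Matrix.SpecialLinearGroup.coe_mul, Matrix.SpecialLinearGroup.coe_mul,
      Matrix.mul_apply, Matrix.mul_apply]
    exact Finset.sum_congr rfl fun k _ => by rw [h]

theorem Cosets.row_mk {d : ℕ} (γ : Matrix.SpecialLinearGroup (Fin (d + 1)) ℤ) :
    Cosets.row (Quotient.mk _ γ : Cosets d) = γ (Fin.last d) :=
  (rightRel_parabolic_iff _ _).1 (Quotient.mk_out γ)

theorem Cosets.row_injective {d : ℕ} : Function.Injective (Cosets.row (d := d)) := by
  intro q q' h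
  rw [← Quotient.out_eq q, ← Quotient.out_eq q']
  exact Quotient.sound ((rightRel_parabolic_iff _ _).2 h)

/-- Primitivity of the bottom row in Bézout form, witnessed by the last column of the inverse.
Pairing m · row = m' · row' with such a vector gives m' ∣ m. -/
theorem Cosets.exists_row_bezout {d : ℕ} (q : Cosets d) : ∃ u : Fin (d + 1) → ℤ, q.row ⬝ᵥ u = 1 := by
  refine ⟨fun k => q.out⁻¹ k (Fin.last d), ?_⟩
  have h : (q.out * q.out⁻¹) (Fin.last d) (Fin.last d) = 1 := by
    rw [mul_inv_cancel]; simp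
  rw [Matrix.SpecialLinearGroup.coe_mul, Matrix.mul_apply] at h
  exact h

theorem Cosets.row_ne_zero {d : ℕ} (q : Cosets d) : q.row ≠ 0 := by
  obtain ⟨u, hu⟩ := q.exists_row_bezout
  intro h
  rw [h, zero_dotProduct] at hu
  exact zero_ne_one hu

theorem smul_row_injective {d : ℕ} :
    Function.Injective fun p : ℕ+ × Cosets d => ((p.1 : ℕ) : ℤ) • p.2.row := by
  rintro ⟨m, q⟩ ⟨m', q'⟩ h
  simp only at h
  have key : ∀ (m m' : ℕ+) (q q' : Cosets d), ((m : ℕ) : ℤ) • q.row = ((m' : ℕ) : ℤ) • q'.row →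
      (m' : ℕ) ∣ (m : ℕ) := by
    intro m m' q q' h
    obtain ⟨u, hu⟩ := q.exists_row_bezout
    have := congrArg (fun v => v ⬝ᵥ u) h
    simp only [smul_dotProduct, hu, smul_eq_mul, mul_one] at this
    exact Int.natCast_dvd_natCast.1 ⟨_, this⟩
  have hm : m = m' := PNat.coe_injective (Nat.dvd_antisymm (key _ _ _ _ h.symm) (key _ _ _ _ h))
  subst hm
  have hq : q.row = q'.row := by
    have h0 : ((m : ℕ) : ℤ) ≠ 0 := by exact_mod_cast m.ne_zero
    exact smul_right_injective _ h0 h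
  rw [Cosets.row_injective hq]

/-- Every nonzero integral vector is uniquely a positive multiple of a bottom row. -/
def vectorEquiv {d : ℕ} (hd : 1 ≤ d) : ℕ+ × Cosets d ≃ {v : Fin (d + 1) → ℤ // v ≠ 0} :=
  Equiv.ofBijective
    (fun p => ⟨((p.1 : ℕ) : ℤ) • p.2.row,
      smul_ne_zero (by exact_mod_cast p.1.ne_zero) p.2.row_ne_zero⟩) <| by
    constructor
    · intro p p' h
      exact smul_row_injective (Subtype.ext_iff.1 h)
    · rintro ⟨v, hv⟩
      obtain ⟨γ, m, hm⟩ := isMulBottomRow v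
      have hm0 : m ≠ 0 := by rintro rfl; exact hv (by rw [hm, zero_smul])
      obtain ⟨δ, hδ⟩ : ∃ δ : Matrix.SpecialLinearGroup (Fin (d + 1)) ℤ,
          v = (m.natAbs : ℤ) • δ (Fin.last d) := by
        rcases lt_or_gt_of_ne hm0 with h | h
        · obtain ⟨δ, hδ⟩ := exists_neg_bottomRow hd γ
          refine ⟨δ, ?_⟩
          rw [hδ, smul_neg, ← neg_smul, hm]
          congr 1; omega
        · refine ⟨γ, ?_⟩
          rw [hm]
          congr 1; omega
      refine ⟨(⟨m.natAbs, Int.natAbs_pos.2 hm0⟩, Quotient.mk _ δ), Subtype.ext ?_⟩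
      simp only [Cosets.row_mk, PNat.mk_coe]
      exact hδ.symm

@[simp]
theorem vectorEquiv_apply {d : ℕ} (hd : 1 ≤ d) (p : ℕ+ × Cosets d) :
    (vectorEquiv hd p : Fin (d + 1) → ℤ) = ((p.1 : ℕ) : ℤ) • p.2.row := rfl

end Cosets

/-! ### Uniqueness of the meromorphic continuation -/

section Continuation

open Filter Topology

/-- By the identity theorem F - G vanishes on a punctured neighbourhood of every point, since it
vanishes near 2. The normal form of F upgrades this to equality at any point where G is analytic,
whatever the values of G at its poles. -/
theorem IsMeromorphicContinuation.eq_of_analyticAt {f F G : ℂ → ℂ}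
    (hF : IsMeromorphicContinuation f F) (hG : MeromorphicOn G Set.univ)
    (hGf : ∀ s : ℂ, 1 < s.re → G s = f s) {s₀ : ℂ} (hs₀ : AnalyticAt ℂ G s₀) : F s₀ = G s₀ := by
  have hFm : MeromorphicOn F Set.univ := fun x hx => (hF.1 hx).meromorphicAt
  have hsub : MeromorphicOn (F - G) Set.univ := hFm.sub hG
  have h2 : meromorphicOrderAt (F - G) 2 = ⊤ := by
    rw [meromorphicOrderAt_eq_top_iff]
    refine Filter.Eventually.filter_mono nhdsWithin_le_nhds ?_
    have : {s : ℂ | 1 < s.re} ∈ 𝓝 (2 : ℂ) :=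
      (isOpen_lt continuous_const continuous_re).mem_nhds (by simp)
    filter_upwards [this] with s hs
    rw [Pi.sub_apply, hF.2 s hs, hGf s hs, sub_self]
  have h0 : meromorphicOrderAt (F - G) s₀ = ⊤ := by
    by_contra h
    exact hsub.meromorphicOrderAt_ne_top_of_isPreconnected isPreconnected_univ (Set.mem_univ s₀)
      (Set.mem_univ 2) h h2
  rw [meromorphicOrderAt_eq_top_iff] at h0
  have h3 : F =ᶠ[𝓝[≠] s₀] G := by
    filter_upwards [h0] with s hs
    exact sub_eq_zero.1 hs
  exact (((hF.1 (Set.mem_univ s₀)).eventuallyEq_nhdsNE_iff_eventuallyEq_nhds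
    hs₀.meromorphicNFAt).1 h3).eq_of_nhds

theorem meromorphicContinuation_eq {f G : ℂ → ℂ} (hG : MeromorphicOn G Set.univ)
    (hGa : ∀ s : ℂ, 1 < s.re → AnalyticAt ℂ G s) (hGf : ∀ s : ℂ, 1 < s.re → G s = f s)
    {s₀ : ℂ} (hs₀ : AnalyticAt ℂ G s₀) : meromorphicContinuation f s₀ = G s₀ := by
  have h : ∃ F, IsMeromorphicContinuation f F := by
    refine ⟨toMeromorphicNFOn G Set.univ, meromorphicNFOn_toMeromorphicNFOn G Set.univ,
      fun s hs => ?_⟩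
    rw [← hGf s hs, toMeromorphicNFOn_eq_toMeromorphicNFAt hG (Set.mem_univ s),
      toMeromorphicNFAt_eq_self.2 (hGa s hs).meromorphicNFAt]
  rw [meromorphicContinuation, dif_pos h]
  exact h.choose_spec.eq_of_analyticAt hG hGf hs₀

end Continuation

/-! ### Symmetry, analyticity and nonvanishing of ξ -/

section CompletedZeta

open ComplexConjugate

theorem conj_ofReal_cpow {x : ℝ} (hx : 0 ≤ x) (s : ℂ) :
    conj ((x : ℂ) ^ s) = (x : ℂ) ^ (conj s) := by
  rw [cpow_conj _ _ (by rw [arg_ofReal_of_nonneg hx]; exact Real.pi_pos.ne), conj_ofReal]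

theorem xi_conj (s : ℂ) : xi (conj s) = conj (xi s) := by
  have key : ∀ s : ℂ, 0 < s.re → xi (conj s) = conj (xi s) := by
    intro s hs
    have h0 : ∀ u : ℂ, 0 < u.re → xi u = Gammaℝ u * riemannZeta u := by
      intro u hu
      rw [riemannZeta_def_of_ne_zero (by rintro rfl; simp at hu), xi,
        mul_div_cancel₀ _ (Gammaℝ_ne_zero_of_re_pos hu)]
    rw [h0 _ hs, h0 _ (by simpa using hs), map_mul, riemannZeta_conj]
    congr 1
    rw [Gammaℝ_def, Gammaℝ_def, map_mul, ← Gamma_conj, map_div₀]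
    congr 1
    · rw [conj_ofReal_cpow Real.pi_pos.le, map_div₀, map_neg, map_ofNat]
    · rw [map_ofNat]
  -- For Re s ≤ 0 the functional equation moves the claim to 1 - s, where the product of the Gamma
  -- factor and ζ is available.
  rcases lt_or_ge 0 s.re with h | h
  · exact key s h
  · have := key (1 - s) (by rw [sub_re, one_re]; linarith)
    rw [map_sub, map_one, xi, xi, completedRiemannZeta_one_sub, completedRiemannZeta_one_sub] at this
    exact this

theorem analyticAt_xi {s : ℂ} (h0 : s ≠ 0) (h1 : s ≠ 1) : AnalyticAt ℂ xi s := by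
  have : DifferentiableOn ℂ xi ({0}ᶜ ∩ {1}ᶜ) := fun u hu =>
    (differentiableAt_completedZeta hu.1 hu.2).differentiableWithinAt
  exact this.analyticAt ((isOpen_compl_singleton.inter isOpen_compl_singleton).mem_nhds ⟨h0, h1⟩)

theorem meromorphicOn_xi : MeromorphicOn xi Set.univ := by
  have : xi = fun s => completedRiemannZeta₀ s - 1 / s - 1 / (1 - s) := by
    ext s; exact completedRiemannZeta_eq s
  rw [this]
  intro s _
  have h : AnalyticAt ℂ completedRiemannZeta₀ s :=
    differentiable_completedZeta₀.analyticAt s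
  fun_prop

theorem xi_ne_zero_of_one_lt_re {s : ℂ} (hs : 1 < s.re) : xi s ≠ 0 := by
  have h0 : s ≠ 0 := by rintro rfl; simp at hs; linarith
  have h := riemannZeta_ne_zero_of_one_le_re hs.le
  rw [riemannZeta_def_of_ne_zero h0] at h
  exact fun h' => h (by rw [xi] at h'; rw [h', zero_div])

theorem xi_eq_of_pos {s : ℂ} (hs : 0 < s.re) : xi s = Gammaℝ s * riemannZeta s := by
  rw [riemannZeta_def_of_ne_zero (by rintro rfl; simp at hs), xi,
    mul_div_cancel₀ _ (Gammaℝ_ne_zero_of_re_pos hs)]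

end CompletedZeta

/-! ### The quadratic form of a lattice: lower bounds and convergence -/

section QuadraticForm

open Matrix

/-- The squared Euclidean length of the lattice vector `v g`. -/
def quad {k : ℕ} (g : Matrix (Fin k) (Fin k) ℝ) (v : Fin k → ℤ) : ℝ :=
  ∑ j, (∑ i, (v i : ℝ) * g i j) ^ 2

theorem quad_nonneg {k : ℕ} (g : Matrix (Fin k) (Fin k) ℝ) (v : Fin k → ℤ) : 0 ≤ quad g v :=
  Finset.sum_nonneg fun _ _ => sq_nonneg _

@[simp]
theorem quad_zero {k : ℕ} (g : Matrix (Fin k) (Fin k) ℝ) : quad g 0 = 0 := by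
  simp [quad]

theorem quad_smul {k : ℕ} (g : Matrix (Fin k) (Fin k) ℝ) (m : ℤ) (v : Fin k → ℤ) :
    quad g (m • v) = (m : ℝ) ^ 2 * quad g v := by
  simp only [quad, Pi.smul_apply, smul_eq_mul, Int.cast_mul, mul_assoc, ← Finset.mul_sum, mul_pow]

theorem one_le_norm_of_ne_zero {k : ℕ} {v : Fin k → ℤ} (hv : v ≠ 0) : 1 ≤ ‖v‖ := by
  obtain ⟨i, hi⟩ := Function.ne_iff.1 hv
  refine le_trans ?_ (norm_le_pi_norm v i)
  rw [Int.norm_eq_abs]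
  exact_mod_cast Int.one_le_abs hi

theorem exists_norm_sq_le_quad {k : ℕ} (g : Matrix (Fin k) (Fin k) ℝ) (hg : g.det ≠ 0) :
    ∃ c > 0, ∀ v : Fin k → ℤ, c * ‖v‖ ^ 2 ≤ quad g v := by
  -- B bounds the inverse matrix, through v = (vg)g⁻¹; the summand 1 keeps it positive even in
  -- dimension 0.
  set B : ℝ := 1 + ∑ i, ∑ j, |g⁻¹ j i| with hB
  have hB0 : 0 < B := by positivity
  refine ⟨(B ^ 2)⁻¹, by positivity, fun v => ?_⟩
  rw [inv_mul_le_iff₀ (by positivity), ← Real.sq_sqrt (quad_nonneg g v), ← mul_pow]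
  refine pow_le_pow_left₀ (norm_nonneg _) ?_ 2
  rw [pi_norm_le_iff_of_nonneg (by positivity)]
  intro i
  set w : Fin k → ℝ := (fun i => (v i : ℝ)) ᵥ* g with hw
  have hwj : ∀ j, |w j| ≤ √(quad g v) := by
    intro j
    rw [← Real.sqrt_sq_eq_abs]
    refine Real.sqrt_le_sqrt ?_
    exact Finset.single_le_sum (f := fun j => (∑ i, (v i : ℝ) * g i j) ^ 2)
      (fun _ _ => sq_nonneg _) (Finset.mem_univ j)
  have hv : (v i : ℝ) = ∑ j, w j * g⁻¹ j i := by
    have : (fun i => (v i : ℝ)) = w ᵥ* g⁻¹ := by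
      rw [hw, vecMul_vecMul, mul_nonsing_inv _ (isUnit_iff_ne_zero.2 hg), vecMul_one]
    exact congrFun this i
  rw [Int.norm_eq_abs, hv]
  calc |∑ j, w j * g⁻¹ j i| ≤ ∑ j, |w j * g⁻¹ j i| := Finset.abs_sum_le_sum_abs _ _
    _ ≤ ∑ j, √(quad g v) * |g⁻¹ j i| := by
        refine Finset.sum_le_sum fun j _ => ?_
        rw [abs_mul]
        exact mul_le_mul_of_nonneg_right (hwj j) (abs_nonneg _)
    _ = (∑ j, |g⁻¹ j i|) * √(quad g v) := by rw [← Finset.mul_sum, mul_comm]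
    _ ≤ B * √(quad g v) := by
        refine mul_le_mul_of_nonneg_right ?_ (Real.sqrt_nonneg _)
        have := Finset.single_le_sum (f := fun i => ∑ j, |g⁻¹ j i|)
          (fun _ _ => Finset.sum_nonneg fun _ _ => abs_nonneg _) (Finset.mem_univ i)
        rw [hB]; exact this.trans (by linarith)

theorem exists_le_quad {k : ℕ} (g : Matrix (Fin k) (Fin k) ℝ) (hg : g.det ≠ 0) :
    ∃ c > 0, ∀ v : Fin k → ℤ, v ≠ 0 → c ≤ quad g v := by
  obtain ⟨c, hc, h⟩ := exists_norm_sq_le_quad g hg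
  refine ⟨c, hc, fun v hv => le_trans ?_ (h v)⟩
  have := one_le_norm_of_ne_zero hv
  nlinarith [one_le_pow₀ this (n := 2)]

theorem quad_pos {k : ℕ} {g : Matrix (Fin k) (Fin k) ℝ} (hg : g.det ≠ 0) {v : Fin k → ℤ}
    (hv : v ≠ 0) : 0 < quad g v := by
  obtain ⟨c, hc, h⟩ := exists_le_quad g hg
  exact hc.trans_le (h v hv)

theorem summable_norm_rpow {k : ℕ} {r : ℝ} (hr : r < -k) :
    Summable fun v : Fin k → ℤ => ‖v‖ ^ r := by
  let b := Pi.basisFun ℝ (Fin k)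
  let L := Submodule.span ℤ (Set.range b)
  let bZ : Module.Basis (Fin k) ℤ L := b.restrictScalars ℤ
  have hrank : Module.finrank ℤ L = k := by
    rw [Module.finrank_eq_card_basis bZ, Fintype.card_fin]
  have h := ZLattice.summable_norm_rpow L r (by rw [hrank]; exact hr)
  refine (bZ.equivFun.symm.toEquiv.summable_iff.2 h).congr fun v => ?_
  simp only [Function.comp_apply, LinearEquiv.coe_toEquiv]
  congr 1
  rw [Module.Basis.equivFun_symm_apply, Submodule.coe_norm]
  have : ((∑ i, v i • bZ i : L) : Fin k → ℝ) = fun i => (v i : ℝ) := by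
    ext j
    rw [Submodule.coe_sum, Finset.sum_apply]
    have hb : ∀ i, ((bZ i : L) : Fin k → ℝ) = Pi.single i 1 := fun i => by
      rw [Module.Basis.restrictScalars_apply, Pi.basisFun_apply]
    simp [hb, Pi.single_apply]
  rw [this]
  simp only [Pi.norm_def]
  norm_num
  congr

theorem summable_quad_rpow {k : ℕ} {g : Matrix (Fin k) (Fin k) ℝ} (hg : g.det ≠ 0) {σ : ℝ}
    (hσ : k / 2 < σ) : Summable fun v : Fin k → ℤ => quad g v ^ (-σ) := by
  have hσ0 : 0 < σ := lt_of_le_of_lt (by positivity) hσ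
  obtain ⟨c, hc, h⟩ := exists_norm_sq_le_quad g hg
  refine Summable.of_nonneg_of_le (fun v => Real.rpow_nonneg (quad_nonneg _ _) _) (fun v => ?_)
    ((summable_norm_rpow (k := k) (r := -(2 * σ)) (by linarith)).mul_left (c ^ (-σ)))
  -- The zero vector is harmless because 0 ^ (-σ) = 0 for σ ≠ 0.
  by_cases hv : v = 0
  · subst hv
    rw [quad_zero, Real.zero_rpow (by linarith)]
    positivity
  · have hn : 0 < ‖v‖ := norm_pos_iff.2 hv
    calc quad g v ^ (-σ) ≤ (c * ‖v‖ ^ 2) ^ (-σ) :=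
          Real.rpow_le_rpow_of_nonpos (by positivity) (h v) (by linarith)
      _ = c ^ (-σ) * ‖v‖ ^ (-(2 * σ)) := by
          rw [Real.mul_rpow hc.le (by positivity), ← Real.rpow_natCast, ← Real.rpow_mul hn.le]
          congr 2; push_cast; ring

theorem summable_exp_quad {k : ℕ} {g : Matrix (Fin k) (Fin k) ℝ} (hg : g.det ≠ 0) {t : ℝ}
    (ht : 0 < t) : Summable fun v : Fin k → ℤ => Real.exp (-Real.pi * quad g v * t) := by
  -- The comparison is exp(-y) ≤ N!/y^N with N = k + 1, large enough for convergence over ℤ^k; the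
  -- term v = 0 is majorised separately by `h2`.
  have h1 := (summable_quad_rpow hg (σ := (k + 1 : ℕ)) (by push_cast; linarith [(k.cast_nonneg : (0:ℝ) ≤ k)])).mul_left
    (((k + 1).factorial : ℝ) / (Real.pi * t) ^ (k + 1))
  have h2 : Summable fun v : Fin k → ℤ => if v = 0 then (1 : ℝ) else 0 :=
    summable_of_hasFiniteSupport ((Set.finite_singleton 0).subset fun v hv => by
      by_contra h; simp at h; simp [h] at hv)
  refine Summable.of_nonneg_of_le (fun v => (Real.exp_pos _).le) (fun v => ?_) (h1.add h2)
  by_cases hv : v = 0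
  · subst hv
    simp only [quad_zero, mul_zero, zero_mul, Real.exp_zero, if_true]
    have : 0 ≤ (((k + 1).factorial : ℝ) / (Real.pi * t) ^ (k + 1)) * (0 : ℝ) ^ (-((k + 1 : ℕ) : ℝ)) := by
      positivity
    linarith
  · have hq := quad_pos hg hv
    rw [if_neg hv, add_zero, show -Real.pi * quad g v * t = -(Real.pi * t * quad g v) by ring,
      Real.exp_neg, Real.rpow_neg hq.le, Real.rpow_natCast, div_mul_eq_mul_div, ← div_eq_mul_inv,
      div_div, ← mul_pow, mul_comm (quad g v)]
    have hy : 0 < Real.pi * t * quad g v := by positivity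
    rw [inv_eq_one_div, div_le_div_iff₀ (Real.exp_pos _) (by positivity), one_mul,
      ← div_le_iff₀' (by positivity)]
    exact Real.pow_div_factorial_le_exp _ hy.le _

theorem quad_snoc {k : ℕ} {g : Matrix (Fin (k + 1)) (Fin (k + 1)) ℝ}
    (hg : ∀ j : Fin k, g (Fin.last k) j.castSucc = 0) (c : Fin k → ℤ) (m : ℤ) :
    quad g (Fin.snoc (α := fun _ => ℤ) c m) = quad (g.submatrix Fin.castSucc Fin.castSucc) c +
      (m * g (Fin.last k) (Fin.last k) + ∑ i, (c i : ℝ) * g i.castSucc (Fin.last k)) ^ 2 := by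
  simp only [quad, Fin.sum_univ_castSucc, Fin.snoc_castSucc, Fin.snoc_last, hg, mul_zero, add_zero,
    Matrix.submatrix_apply]
  ring

end QuadraticForm

/-! ### Theta series: decay at infinity and summation over the last coordinate -/

section Theta

open Filter Topology Asymptotics HurwitzZeta

/-- The theta function of the lattice spanned by the rows of `g`. -/
def theta {k : ℕ} (g : Matrix (Fin k) (Fin k) ℝ) (t : ℝ) : ℝ :=
  ∑' v : Fin k → ℤ, Real.exp (-Real.pi * quad g v * t)

theorem continuousOn_theta {k : ℕ} {g : Matrix (Fin k) (Fin k) ℝ} (hg : g.det ≠ 0) :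
    ContinuousOn (theta g) (Set.Ioi 0) := by
  intro t₀ ht₀
  have h0 : (0 : ℝ) < t₀ / 2 := half_pos ht₀
  have : ContinuousOn (theta g) (Set.Ioi (t₀ / 2)) := by
    refine continuousOn_tsum (fun v => by fun_prop) (summable_exp_quad hg h0) fun v t ht => ?_
    rw [Real.norm_of_nonneg (Real.exp_pos _).le, Real.exp_le_exp]
    have := mul_nonneg Real.pi_pos.le (quad_nonneg g v)
    have ht' : t₀ / 2 < t := ht
    nlinarith
  exact (this.continuousAt (Ioi_mem_nhds (half_lt_self ht₀))).continuousWithinAt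

theorem hasSum_theta_sub_one {k : ℕ} {g : Matrix (Fin k) (Fin k) ℝ} (hg : g.det ≠ 0) {t : ℝ}
    (ht : 0 < t) : HasSum (fun v : Fin k → ℤ => if v = 0 then 0 else Real.exp (-Real.pi * quad g v * t))
      (theta g t - 1) := by
  have := hasSum_ite_sub_hasSum (summable_exp_quad hg ht).hasSum 0
  simpa [theta] using! this

theorem theta_sub_one_isBigO {k : ℕ} {g : Matrix (Fin k) (Fin k) ℝ} (hg : g.det ≠ 0) :
    ∃ p > 0, (fun t => theta g t - 1) =O[atTop] fun t => Real.exp (-p * t) := by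
  obtain ⟨c, hc, h⟩ := exists_le_quad g hg
  refine ⟨Real.pi * c, by positivity, ?_⟩
  -- For t ≥ 1 and Q ≥ c one has exp(-πQt) ≤ exp(-πQ) exp(-πc(t - 1)), so the value at t = 1 serves
  -- as the constant.
  refine IsBigO.of_bound ((theta g 1 - 1) * Real.exp (Real.pi * c)) ?_
  filter_upwards [eventually_ge_atTop 1] with t ht
  have ht0 : 0 < t := by linarith
  have h1 := hasSum_theta_sub_one hg ht0
  have h2 := hasSum_theta_sub_one hg one_pos
  rw [Real.norm_of_nonneg (h1.nonneg fun v => by split_ifs <;> positivity),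
    Real.norm_of_nonneg (Real.exp_pos _).le, mul_assoc, ← Real.exp_add]
  refine hasSum_le (fun v => ?_) h1 (h2.mul_right _)
  split_ifs with hv
  · simp
  · rw [← Real.exp_add, Real.exp_le_exp]
    have := mul_le_mul_of_nonneg_left (h v hv) Real.pi_pos.le
    nlinarith

theorem abs_cosKernel_sub_one_le (β : ℝ) {x : ℝ} (hx : 0 < x) :
    |cosKernel β x - 1| ≤ cosKernel (0 : ℝ) x - 1 := by
  have h1 := hasSum_nat_cosKernel₀ β hx
  have h2 := hasSum_nat_cosKernel₀ 0 hx
  have key : ∀ n : ℕ, ‖2 * Real.cos (2 * Real.pi * β * (n + 1)) * Real.exp (-Real.pi * (n + 1) ^ 2 * x)‖ ≤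
      2 * Real.cos (2 * Real.pi * 0 * (n + 1)) * Real.exp (-Real.pi * (n + 1) ^ 2 * x) := by
    intro n
    rw [norm_mul, norm_mul, Real.norm_of_nonneg (Real.exp_pos _).le]
    refine mul_le_mul_of_nonneg_right ?_ (Real.exp_pos _).le
    simpa using Real.abs_cos_le_one _
  rw [← h1.tsum_eq, ← h2.tsum_eq, ← Real.norm_eq_abs]
  exact tsum_of_norm_bounded h2.summable.hasSum key

/-- For fixed c the last coordinate m enters only through (mδ + p)² = δ²(m + p/δ)², so its sum is a
one-dimensional theta series shifted by p/δ. -/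
theorem theta_succ {k : ℕ} {g : Matrix (Fin (k + 1)) (Fin (k + 1)) ℝ} (hdet : g.det ≠ 0)
    (hg : ∀ j : Fin k, g (Fin.last k) j.castSucc = 0) (hδ : g (Fin.last k) (Fin.last k) ≠ 0)
    {t : ℝ} (ht : 0 < t) :
    HasSum (fun c : Fin k → ℤ =>
      Real.exp (-Real.pi * quad (g.submatrix Fin.castSucc Fin.castSucc) c * t) *
        evenKernel (((∑ i, (c i : ℝ) * g i.castSucc (Fin.last k)) / g (Fin.last k) (Fin.last k) : ℝ))
          (g (Fin.last k) (Fin.last k) ^ 2 * t)) (theta g t) := by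
  set δ := g (Fin.last k) (Fin.last k)
  have h1 := (summable_exp_quad hdet ht).hasSum
  have h2 := ((Equiv.prodComm _ _).trans (Fin.snocEquiv fun _ : Fin (k + 1) => ℤ)).hasSum_iff.2 h1
  refine h2.prod_fiberwise fun c => ?_
  have h3 := (hasSum_int_evenKernel ((∑ i, (c i : ℝ) * g i.castSucc (Fin.last k)) / δ)
    (mul_pos (sq_pos_of_ne_zero hδ) ht)).mul_left
      (Real.exp (-Real.pi * quad (g.submatrix Fin.castSucc Fin.castSucc) c * t))
  refine h3.congr_fun fun m => ?_
  change Real.exp (-Real.pi * quad g (Fin.snoc (α := fun _ => ℤ) c m) * t) = _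
  rw [quad_snoc hg, ← Real.exp_add]
  congr 1
  have hδ' : g (Fin.last k) (Fin.last k) = δ := rfl
  rw [hδ']
  field_simp
  ring

end Theta

/-! ### Behaviour of theta series at zero -/

section Asymptotics

open Filter Topology Asymptotics HurwitzZeta

theorem cosKernel_sub_one_isBigO {δ : ℝ} (hδ : δ ≠ 0) (N : ℝ) :
    (fun t : ℝ => cosKernel (0 : ℝ) (1 / (δ ^ 2 * t)) - 1) =O[𝓝[>] 0] fun t => t ^ N := by
  obtain ⟨p, hp, h⟩ := isBigO_atTop_cosKernel_sub ((0 : ℝ) : UnitAddCircle)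
  have h1 := h.trans (isLittleO_exp_neg_mul_rpow_atTop hp (-N)).isBigO
  have hδ2 : 0 < δ ^ 2 := sq_pos_of_ne_zero hδ
  have h2 : Tendsto (fun t : ℝ => 1 / (δ ^ 2 * t)) (𝓝[>] 0) atTop := by
    simp only [one_div, mul_inv]
    exact Tendsto.const_mul_atTop (inv_pos.2 hδ2) tendsto_inv_nhdsGT_zero
  refine (h1.comp_tendsto h2).trans ?_
  refine IsBigO.of_bound ((δ ^ 2) ^ N) ?_
  filter_upwards [self_mem_nhdsWithin] with t ht
  have ht : 0 < t := ht
  rw [Function.comp_apply, one_div, Real.inv_rpow (by positivity), Real.rpow_neg (by positivity),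
    inv_inv, Real.mul_rpow hδ2.le ht.le, Real.norm_of_nonneg (by positivity),
    Real.norm_of_nonneg (by positivity)]

theorem det_ne_zero_of_upperTriangular {k : ℕ} {g : Matrix (Fin k) (Fin k) ℝ}
    (htri : ∀ i j, j < i → g i j = 0) (hdiag : ∀ i, g i i ≠ 0) : g.det ≠ 0 := by
  rw [Matrix.det_of_isUpperTriangular (fun i j h => htri i j h)]
  exact Finset.prod_ne_zero_iff.2 fun i _ => hdiag i

/-- Induction on the size. Poisson summation in the last coordinate gives θ_g(t) = (δ²t)^{-1/2}
θ_M(t) up to an error smaller than every power of t, and the exponent drops by 1/2 at each step. For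
triangular matrices this replaces Poisson summation on the dual lattice. The constant does not
depend on N. -/
theorem theta_asymptotic {k : ℕ} {g : Matrix (Fin k) (Fin k) ℝ}
    (htri : ∀ i j, j < i → g i j = 0) (hdiag : ∀ i, g i i ≠ 0) :
    ∃ C : ℝ, ∀ N : ℝ,
      (fun t => theta g t - C * t ^ (-(k / 2 : ℝ))) =O[𝓝[>] 0] fun t : ℝ => t ^ N := by
  induction k with
  | zero =>
    refine ⟨1, fun N => ?_⟩
    have : (fun t => theta g t - 1 * t ^ (-((0 : ℕ) / 2 : ℝ))) = fun _ => 0 := by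
      ext t
      rw [theta, tsum_eq_single 0 (fun v hv => absurd (Subsingleton.elim v 0) hv), quad_zero]
      simp
    rw [this]
    exact isBigO_zero _ _
  | succ k ih =>
    set M := g.submatrix Fin.castSucc Fin.castSucc with hM
    have hMtri : ∀ i j, j < i → M i j = 0 := fun i j h => htri _ _ (Fin.castSucc_lt_castSucc_iff.2 h)
    have hMdiag : ∀ i, M i i ≠ 0 := fun i => hdiag _
    obtain ⟨C, hC⟩ := ih hMtri hMdiag
    have hMdet := det_ne_zero_of_upperTriangular hMtri hMdiag
    have hgdet := det_ne_zero_of_upperTriangular htri hdiag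
    set δ := g (Fin.last k) (Fin.last k) with hδdef
    have hδ : δ ≠ 0 := hdiag _
    have hδ2 : 0 < δ ^ 2 := sq_pos_of_ne_zero hδ
    refine ⟨C / (δ ^ 2) ^ (1 / 2 : ℝ), fun N => ?_⟩
    have hr : (fun t : ℝ => 1 / (δ ^ 2 * t) ^ (1 / 2 : ℝ)) =O[𝓝[>] 0] fun t => t ^ (-(1 / 2) : ℝ) := by
      refine IsBigO.of_bound (1 / (δ ^ 2) ^ (1 / 2 : ℝ)) ?_
      filter_upwards [self_mem_nhdsWithin] with t ht
      have ht : 0 < t := ht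
      rw [Real.mul_rpow hδ2.le ht.le, Real.rpow_neg ht.le, Real.norm_of_nonneg (by positivity),
        Real.norm_of_nonneg (by positivity)]
      exact le_of_eq (by field_simp)
    have hthM : theta M =O[𝓝[>] 0] fun t => t ^ (-(k / 2 : ℝ)) := by
      have := (hC (-(k / 2 : ℝ))).add ((isBigO_refl (fun t : ℝ => t ^ (-(k / 2 : ℝ))) (𝓝[>] 0)).const_mul_left C)
      simpa using this
    have hmul : ∀ {u : ℝ → ℝ} {a b c : ℝ}, a + b = c →
        u =O[𝓝[>] 0] (fun t : ℝ => t ^ a * t ^ b) → u =O[𝓝[>] 0] fun t : ℝ => t ^ c := by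
      intro u a b c habc h
      refine h.congr' EventuallyEq.rfl ?_
      filter_upwards [self_mem_nhdsWithin] with t ht
      rw [← Real.rpow_add ht, habc]
    -- Replacing each `cosKernel` by its constant term 1 costs at most `cosKernel 0 - 1`, uniformly
    -- in the shift, so the error factors out of the sum over c.
    have h1 : (fun t => theta g t - 1 / (δ ^ 2 * t) ^ (1 / 2 : ℝ) * theta M t) =O[𝓝[>] 0]
        fun t : ℝ => t ^ N := by
      have hb : (fun t => theta g t - 1 / (δ ^ 2 * t) ^ (1 / 2 : ℝ) * theta M t) =O[𝓝[>] 0]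
          fun t => theta M t * (1 / (δ ^ 2 * t) ^ (1 / 2 : ℝ) *
            (cosKernel (0 : ℝ) (1 / (δ ^ 2 * t)) - 1)) := by
        refine IsBigO.of_bound 1 ?_
        filter_upwards [self_mem_nhdsWithin] with t ht
        have ht : 0 < t := ht
        have hx : 0 < δ ^ 2 * t := by positivity
        have e1 := theta_succ hgdet (fun j => htri _ _ (Fin.castSucc_lt_last j)) hδ ht
        have e2 := (summable_exp_quad hMdet ht).hasSum
        have e3 := e1.sub (e2.mul_right (1 / (δ ^ 2 * t) ^ (1 / 2 : ℝ)))
        have e4 := e2.mul_right (1 / (δ ^ 2 * t) ^ (1 / 2 : ℝ) *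
            (cosKernel (0 : ℝ) (1 / (δ ^ 2 * t)) - 1))
        have hcos0 : 0 ≤ cosKernel (0 : ℝ) (1 / (δ ^ 2 * t)) - 1 :=
          (abs_nonneg _).trans (abs_cosKernel_sub_one_le 0 (by positivity))
        have hθ0 : 0 ≤ theta M t := tsum_nonneg fun _ => (Real.exp_pos _).le
        rw [one_mul, Real.norm_of_nonneg (mul_nonneg hθ0 (mul_nonneg (by positivity) hcos0)),
          mul_comm (1 / (δ ^ 2 * t) ^ (1 / 2 : ℝ)) (theta M t)]
        change ‖theta g t - (∑' v, _) * _‖ ≤ (∑' v, _) * _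
        rw [← e3.tsum_eq, ← e4.tsum_eq]
        refine tsum_of_norm_bounded e4.summable.hasSum fun c => ?_
        rw [← mul_sub, norm_mul, Real.norm_of_nonneg (Real.exp_pos _).le]
        refine mul_le_mul_of_nonneg_left ?_ (Real.exp_pos _).le
        rw [evenKernel_functional_equation, ← mul_sub_one, norm_mul,
          Real.norm_of_nonneg (by positivity)]
        exact mul_le_mul_of_nonneg_left (abs_cosKernel_sub_one_le _ (by positivity)) (by positivity)
      refine hb.trans ?_
      refine hmul (a := -(k / 2 : ℝ)) (b := k / 2 + N) (by ring) (hthM.mul ?_)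
      exact hmul (a := -(1 / 2)) (b := 1 / 2 + (k / 2 + N)) (by ring)
        (hr.mul (cosKernel_sub_one_isBigO hδ _))
    have h2 : (fun t => 1 / (δ ^ 2 * t) ^ (1 / 2 : ℝ) * (theta M t - C * t ^ (-(k / 2 : ℝ)))) =O[𝓝[>] 0]
        fun t : ℝ => t ^ N :=
      hmul (a := -(1 / 2)) (b := 1 / 2 + N) (by ring) (hr.mul (hC _))
    refine (h1.add h2).congr' ?_ EventuallyEq.rfl
    filter_upwards [self_mem_nhdsWithin] with t ht
    have ht : 0 < t := ht
    have : t ^ (-((k + 1 : ℕ) / 2 : ℝ)) = t ^ (-(k / 2 : ℝ)) / t ^ (1 / 2 : ℝ) := by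
      rw [← Real.rpow_sub ht]; congr 1; push_cast; ring
    rw [this, Real.mul_rpow hδ2.le ht.le]
    field_simp
    ring

end Asymptotics

/-! ### Meromorphic continuation of the Mellin transform of a theta series -/

section MellinContinuation

open Filter Topology Asymptotics ComplexConjugate

theorem mellin_conj (f : ℝ → ℝ) (s : ℂ) :
    mellin (fun t => (f t : ℂ)) (conj s) = conj (mellin (fun t => (f t : ℂ)) s) := by
  rw [mellin, mellin, ← integral_conj]
  refine setIntegral_congr_fun measurableSet_Ioi fun t ht => ?_
  simp only [smul_eq_mul, map_mul, conj_ofReal]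
  rw [conj_ofReal_cpow (le_of_lt ht), map_sub, map_one]

theorem isBigO_ofReal {f g : ℝ → ℝ} {l : Filter ℝ} (h : f =O[l] g) :
    (fun t => (f t : ℂ)) =O[l] g :=
  (isBigO_of_le l fun t => by simp).trans h

/-- Subtracting the principal part C t^{-k/2} - 1 on (0,1] leaves a function with entire Mellin
transform; the principal part itself contributes C/(w - k/2) - 1/w. Everything is real, whence the
symmetry under conjugation. -/
theorem exists_mellin_theta_continuation {k : ℕ} {g : Matrix (Fin k) (Fin k) ℝ}
    (htri : ∀ i j, j < i → g i j = 0) (hdiag : ∀ i, g i i ≠ 0) :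
    ∃ Λ : ℂ → ℂ, MeromorphicOn Λ Set.univ ∧
      (∀ w : ℂ, w ≠ 0 → w ≠ k / 2 → AnalyticAt ℂ Λ w) ∧
      (∀ w : ℂ, Λ (conj w) = conj (Λ w)) ∧
      ∀ w : ℂ, (k / 2 : ℝ) < w.re → HasMellin (fun t => ((theta g t - 1 : ℝ) : ℂ)) w (Λ w) := by
  obtain ⟨C, hC⟩ := theta_asymptotic htri hdiag
  have hdet := det_ne_zero_of_upperTriangular htri hdiag
  set φ : ℝ → ℝ := fun t => C * t ^ (-(k / 2 : ℝ)) - 1 with hφ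
  -- Truncation at 1 leaves the exponential decay at infinity intact.
  set ψ : ℝ → ℝ := (Set.Ioc 0 1).indicator φ with hψ
  set F : ℝ → ℝ := fun t => theta g t - 1 - ψ t with hF
  have hθint : LocallyIntegrableOn (fun t => theta g t - 1) (Set.Ioi 0) :=
    ((continuousOn_theta hdet).sub continuousOn_const).locallyIntegrableOn measurableSet_Ioi
  have hφint : LocallyIntegrableOn φ (Set.Ioi 0) := by
    refine ContinuousOn.locallyIntegrableOn ?_ measurableSet_Ioi
    refine (ContinuousOn.const_mul ?_ _).sub continuousOn_const
    intro t ht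
    exact (Real.continuousAt_rpow_const _ _ (Or.inl (ne_of_gt ht))).continuousWithinAt
  have hψint : LocallyIntegrableOn ψ (Set.Ioi 0) := by
    intro t ht
    obtain ⟨u, hu, hint⟩ := hφint t ht
    exact ⟨u, hu, Integrable.indicator hint measurableSet_Ioc⟩
  have hFint : LocallyIntegrableOn (fun t => (F t : ℂ)) (Set.Ioi 0) := by
    have h := hθint.sub hψint
    intro t ht
    obtain ⟨u, hu, hint⟩ := h t ht
    exact ⟨u, hu, Integrable.ofReal hint⟩
  have htop : ∀ a : ℝ, (fun t => (F t : ℂ)) =O[atTop] fun t : ℝ => t ^ (-a) := by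
    intro a
    obtain ⟨p, hp, h⟩ := theta_sub_one_isBigO hdet
    refine isBigO_ofReal ((h.trans (isLittleO_exp_neg_mul_rpow_atTop hp (-a)).isBigO).congr' ?_
      EventuallyEq.rfl)
    filter_upwards [eventually_gt_atTop 1] with t ht
    simp only [hF, hψ]
    rw [Set.indicator_of_notMem (fun h => ht.not_ge h.2), sub_zero]
  have hbot : ∀ b : ℝ, (fun t => (F t : ℂ)) =O[𝓝[>] 0] fun t : ℝ => t ^ (-b) := by
    intro b
    refine isBigO_ofReal ((hC (-b)).congr' ?_ EventuallyEq.rfl)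
    filter_upwards [Ioc_mem_nhdsGT one_pos] with t ht
    simp only [hF, hψ]
    rw [Set.indicator_of_mem ht, hφ]
    ring
  have hdiff : Differentiable ℂ (mellin fun t => (F t : ℂ)) := fun w =>
    mellin_differentiableAt_of_isBigO_rpow hFint (htop (w.re + 1)) (by linarith)
      (hbot (w.re - 1)) (by linarith)
  refine ⟨fun w => mellin (fun t => (F t : ℂ)) w + (C / (w - k / 2) - 1 / w), ?_, ?_, ?_, ?_⟩
  · intro w _
    have := hdiff.analyticAt w
    fun_prop
  · intro w h0 h1
    have := hdiff.analyticAt w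
    have h2 : w - k / 2 ≠ 0 := sub_ne_zero.2 h1
    fun_prop (disch := assumption)
  · intro w
    simp [mellin_conj, map_ofNat]
  · intro w hw
    have hk : (0 : ℝ) ≤ k / 2 := by positivity
    have h1 : MellinConvergent (fun t => (F t : ℂ)) w :=
      mellinConvergent_of_isBigO_rpow hFint (htop (w.re + 1)) (by linarith)
        (hbot (w.re - 1)) (by linarith)
    have h2 := hasMellin_cpow_Ioc (-(k / 2) : ℂ) (s := w) (by
      rw [neg_re, show ((k : ℂ) / 2).re = (k / 2 : ℝ) by simp]; linarith)
    have h3 := hasMellin_one_Ioc (s := w) (by linarith)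
    have h4 := hasMellin_sub (hasMellin_const_smul h2.1 (C : ℂ)).1 h3.1
    have h5 := hasMellin_add h1 h4.1
    have hfun : (fun t => (F t : ℂ) + ((C : ℂ) • (Set.Ioc 0 1).indicator (fun t : ℝ => (t : ℂ) ^ (-(k / 2) : ℂ)) t -
        (Set.Ioc 0 1).indicator (fun _ => 1) t)) = fun t => ((theta g t - 1 : ℝ) : ℂ) := by
      ext t
      by_cases ht : t ∈ Set.Ioc (0 : ℝ) 1
      · simp only [hF, hψ, hφ, Set.indicator_of_mem ht]
        push_cast [ofReal_cpow ht.1.le]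
        simp only [smul_eq_mul]
        ring
      · simp only [hF, hψ, Set.indicator_of_notMem ht]
        simp
    rw [hfun] at h5
    refine ⟨h5.1, h5.2.trans ?_⟩
    rw [h4.2, (hasMellin_const_smul h2.1 (C : ℂ)).2, h2.2, h3.2, smul_eq_mul]
    ring

end MellinContinuation

/-! ### The Eisenstein series as the Mellin transform of a theta series -/

section EisensteinSeries

open Matrix

theorem Cosets.det_rep {d : ℕ} (q : Cosets d) : q.rep.det = 1 := by
  have h : q.rep = (Int.castRingHom ℝ).mapMatrix (q.out : Matrix (Fin (d + 1)) (Fin (d + 1)) ℤ) := rfl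
  rw [h, ← RingHom.map_det, Matrix.SpecialLinearGroup.det_coe, map_one]

theorem sum_bottomRow_rep_mul {d : ℕ} (q : Cosets d) (g : Matrix (Fin (d + 1)) (Fin (d + 1)) ℝ) :
    ∑ j, (q.rep * g) (Fin.last d) j ^ 2 = quad g q.row := rfl

theorem detY_rep_mul {d : ℕ} (q : Cosets d) {g : Matrix (Fin (d + 1)) (Fin (d + 1)) ℝ}
    (hg : g.det ≠ 0) : detY (q.rep * g) = |g.det| / √(quad g q.row) ^ (d + 1) := by
  rw [detY_eq _ (by rw [det_mul, q.det_rep, one_mul]; exact hg), det_mul, q.det_rep, one_mul,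
    sum_bottomRow_rep_mul]

theorem quad_row_pos {d : ℕ} (q : Cosets d) {g : Matrix (Fin (d + 1)) (Fin (d + 1)) ℝ}
    (hg : g.det ≠ 0) : 0 < quad g q.row := quad_pos hg q.row_ne_zero

theorem eisensteinSeries_eq {d : ℕ} {g : Matrix (Fin (d + 1)) (Fin (d + 1)) ℝ}
    (hg : g.det ≠ 0) (s : ℂ) :
    eisensteinSeries d g s =
      ((|g.det| : ℝ) : ℂ) ^ s * ∑' q : Cosets d, (quad g q.row : ℂ) ^ (-((d + 1) * s / 2)) := by
  rw [eisensteinSeries, ← tsum_mul_left]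
  refine tsum_congr fun q => ?_
  have hQ := quad_row_pos q hg
  have hD : 0 < |g.det| := abs_pos.2 hg
  rw [detY_rep_mul q hg, Real.sqrt_eq_rpow, ← Real.rpow_natCast, ← Real.rpow_mul hQ.le, div_eq_mul_inv,
    ← Real.rpow_neg hQ.le, ofReal_mul, mul_cpow_ofReal_nonneg hD.le (Real.rpow_nonneg hQ.le _)]
  congr 1
  rw [ofReal_cpow hQ.le, ← ofReal_cpow hQ.le, cpow_def_of_ne_zero (by
    exact_mod_cast (Real.rpow_pos_of_pos hQ _).ne'), cpow_def_of_ne_zero (by exact_mod_cast hQ.ne'),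
    ← ofReal_log (Real.rpow_nonneg hQ.le _), Real.log_rpow hQ, ← ofReal_log hQ.le]
  congr 1
  push_cast
  ring

theorem hasSum_pnat_cpow {s : ℂ} (hs : 1 < s.re) :
    HasSum (fun m : ℕ+ => ((m : ℕ) : ℂ) ^ (-s)) (riemannZeta s) := by
  have h0 : s ≠ 0 := by rintro rfl; simp at hs; linarith
  have h1 : HasSum (fun n : ℕ => 1 / (n : ℂ) ^ s) (riemannZeta s) := by
    rw [zeta_eq_tsum_one_div_nat_cpow hs]
    exact (summable_one_div_nat_cpow.2 hs).hasSum
  have h2 := (hasSum_subtype_iff_of_support_subset (s := {n : ℕ | 0 < n}) (fun n hn => by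
    rcases Nat.eq_zero_or_pos n with rfl | h
    · simp [h0] at hn
    · exact h)).2 h1
  refine HasSum.congr_fun (f := fun m : ℕ+ => 1 / ((m : ℕ) : ℂ) ^ s) h2 fun m => ?_
  rw [cpow_neg, one_div]

theorem summable_quad_cpow {k : ℕ} {g : Matrix (Fin k) (Fin k) ℝ} (hg : g.det ≠ 0) {w : ℂ}
    (hw : (k / 2 : ℝ) < w.re) : Summable fun v : Fin k → ℤ => (quad g v : ℂ) ^ (-w) := by
  refine Summable.of_norm_bounded (summable_quad_rpow hg hw) fun v => ?_
  have h0 : 0 < w.re := lt_of_le_of_lt (by positivity) hw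
  rw [norm_cpow_eq_rpow_re_of_nonneg (quad_nonneg g v) (by rw [neg_re]; linarith), neg_re]

/-- Integrating θ - 1 termwise gives π^{-w}Γ(w) ∑ Q(v)^{-w} over v ≠ 0. Writing v = m · row, the sum
over m splits off as ζ(2w), which together with the Gamma factor is ξ(2w). -/
theorem eisensteinSeries_mul_xi {d : ℕ} (hd : 1 ≤ d) {g : Matrix (Fin (d + 1)) (Fin (d + 1)) ℝ}
    (hg : g.det ≠ 0) {s : ℂ} (hs : 1 < s.re) :
    eisensteinSeries d g s * xi ((d + 1) * s) =
      ((|g.det| : ℝ) : ℂ) ^ s * mellin (fun t => ((theta g t - 1 : ℝ) : ℂ)) ((d + 1) * s / 2) := by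
  set w : ℂ := (d + 1) * s / 2 with hw
  have hre : (((d + 1) * s : ℂ)).re = (d + 1) * s.re := by
    rw [show ((d : ℂ) + 1) = ((d + 1 : ℝ) : ℂ) by push_cast; rfl, re_ofReal_mul]
  have hwre : w.re = (d + 1) * s.re / 2 := by rw [hw, div_ofNat_re, hre]
  have hd0 : (0 : ℝ) < d + 1 := by positivity
  have hw1 : (((d + 1 : ℕ) : ℝ) / 2) < w.re := by
    rw [hwre]; push_cast; nlinarith
  have hw0 : 0 < w.re := lt_trans (by positivity) hw1
  have hd1 : (1 : ℝ) ≤ d := by exact_mod_cast hd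
  have h2w : 1 < (2 * w).re := by
    rw [show (2 * w).re = 2 * w.re by simp]; push_cast at hw1; linarith
  rw [eisensteinSeries_eq hg, mul_assoc]
  congr 1
  -- The coefficient 0 at v = 0 encodes the subtraction of 1 from θ.
  have hm := hasSum_mellin_pi_mul (a := fun v : Fin (d + 1) → ℤ => if v = 0 then 0 else 1)
    (q := quad g) (F := fun t => ((theta g t - 1 : ℝ) : ℂ)) (s := w)
    (fun v => by
      by_cases hv : v = 0
      · simp [hv]
      · exact Or.inr (quad_pos hg hv)) hw0
    (fun t ht => by
      have := hasSum_ofReal.2 (hasSum_theta_sub_one hg ht)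
      refine this.congr_fun fun v => ?_
      split_ifs <;> simp)
    (by
      refine Summable.of_nonneg_of_le (fun v => by positivity [Real.rpow_nonneg (quad_nonneg g v) w.re])
        (fun v => ?_) (summable_quad_rpow hg hw1)
      rw [Real.rpow_neg (quad_nonneg g v), ← one_div]
      refine div_le_div_of_nonneg_right ?_ (Real.rpow_nonneg (quad_nonneg g v) _)
      split_ifs <;> simp)
  have hsub := (hasSum_subtype_iff_of_support_subset (s := {v : Fin (d + 1) → ℤ | v ≠ 0})
    (fun v hv => by
      rintro rfl
      simp at hv)).2 hm
  have hprod := (vectorEquiv hd).hasSum_iff.2 hsub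
  set S := ∑' q : Cosets d, (quad g q.row : ℂ) ^ (-w) with hS
  have hSs : Summable fun q : Cosets d => (quad g q.row : ℂ) ^ (-w) :=
    (summable_quad_cpow hg hw1).comp_injective Cosets.row_injective
  have hfib := hprod.prod_fiberwise (g := fun m : ℕ+ => Gammaℝ (2 * w) * ((m : ℕ) : ℂ) ^ (-(2 * w)) * S)
    (fun m => by
      refine (hSs.hasSum.mul_left (Gammaℝ (2 * w) * ((m : ℕ) : ℂ) ^ (-(2 * w)))).congr_fun fun q => ?_
      have hQ := quad_row_pos q hg
      have hm0 : (0 : ℝ) < (m : ℕ) := by exact_mod_cast m.pos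
      have hv : ((m : ℕ) : ℤ) • q.row ≠ 0 :=
        smul_ne_zero (by exact_mod_cast m.ne_zero) q.row_ne_zero
      simp only [Function.comp_apply]
      rw [if_neg (show ((vectorEquiv hd (m, q) : Fin (d + 1) → ℤ)) ≠ 0 from hv), mul_one,
        vectorEquiv_apply, quad_smul, ofReal_mul, mul_cpow_ofReal_nonneg (by positivity) hQ.le, Gammaℝ_def,
        show -(2 * w) / 2 = -w by ring, show 2 * w / 2 = w by ring]
      have : ((((m : ℕ) : ℤ) : ℝ) ^ 2 : ℝ) = (((m : ℕ) : ℝ) ^ 2) := by push_cast; rfl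
      rw [this]
      have h3 : ((((m : ℕ) : ℝ) ^ 2 : ℝ) : ℂ) ^ w = ((m : ℕ) : ℂ) ^ (2 * w) := by
        rw [← ofReal_natCast, cpow_def_of_ne_zero (by exact_mod_cast (pow_pos hm0 2).ne'),
          cpow_def_of_ne_zero (by exact_mod_cast hm0.ne'), ← ofReal_log (by positivity),
          ← ofReal_log hm0.le, Real.log_pow]
        congr 1; push_cast; ring
      rw [h3, div_eq_mul_inv, mul_inv, ← cpow_neg, ← cpow_neg]
      ring)
  have hz := ((hasSum_pnat_cpow h2w).mul_left (Gammaℝ (2 * w))).mul_right S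
  rw [show ((d : ℂ) + 1) * s = 2 * w by rw [hw]; ring, xi_eq_of_pos (by linarith)]
  rw [hfib.unique hz]
  ring

end EisensteinSeries

/-! ### Values of the continued Eisenstein series for triangular matrices -/

section LeviContinuation

open ComplexConjugate

theorem analyticAt_ofReal_cpow {x : ℝ} (hx : 0 < x) {f : ℂ → ℂ} {s : ℂ} (hf : AnalyticAt ℂ f s) :
    AnalyticAt ℂ (fun s => (x : ℂ) ^ f s) s :=
  analyticAt_const.cpow hf (Or.inl (by simpa using hx))

/-- The same Λ is both the continued Mellin transform and the numerator of `E`. Applied to the Levi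
block, this identifies the Λ occurring in the expansion on the larger group with an Eisenstein
series. -/
theorem exists_mellin_continuation_E {d : ℕ} (hd : 1 ≤ d) {g : Matrix (Fin (d + 1)) (Fin (d + 1)) ℝ}
    (htri : ∀ i j, j < i → g i j = 0) (hdiag : ∀ i, g i i ≠ 0) :
    ∃ Λ : ℂ → ℂ, MeromorphicOn Λ Set.univ ∧
      (∀ w : ℂ, w ≠ 0 → w ≠ (d + 1) / 2 → AnalyticAt ℂ Λ w) ∧
      (∀ w : ℂ, Λ (conj w) = conj (Λ w)) ∧
      (∀ w : ℂ, ((d + 1) / 2 : ℝ) < w.re →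
        HasMellin (fun t => ((theta g t - 1 : ℝ) : ℂ)) w (Λ w)) ∧
      ∀ s : ℂ, (d + 1) * s ≠ 0 → (d + 1) * s ≠ 1 → s ≠ 1 → xi ((d + 1) * s) ≠ 0 →
        E d g s = ((|g.det| : ℝ) : ℂ) ^ s * Λ ((d + 1) * s / 2) / xi ((d + 1) * s) := by
  obtain ⟨Λ, hmer, han, hconj, hmel⟩ := exists_mellin_theta_continuation htri hdiag
  simp only [Nat.cast_add, Nat.cast_one] at han hmel
  have hdet := det_ne_zero_of_upperTriangular htri hdiag
  have hD : 0 < |g.det| := abs_pos.2 hdet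
  refine ⟨Λ, hmer, han, hconj, hmel, fun s h0 h1 hs1 hxi => ?_⟩
  have hd0 : (d : ℂ) + 1 ≠ 0 := by exact_mod_cast d.succ_ne_zero
  have hGa : ∀ s : ℂ, (d + 1) * s ≠ 0 → (d + 1) * s ≠ 1 → s ≠ 1 → xi ((d + 1) * s) ≠ 0 →
      AnalyticAt ℂ (fun s => ((|g.det| : ℝ) : ℂ) ^ s * Λ ((d + 1) * s / 2) / xi ((d + 1) * s)) s := by
    intro s h0 h1 hs1 hxi
    have a1 : AnalyticAt ℂ (fun s => Λ ((d + 1) * s / 2)) s := by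
      refine AnalyticAt.fun_comp (han _ (div_ne_zero h0 two_ne_zero) fun h => hs1 ?_) (by fun_prop)
      have := (div_left_inj' two_ne_zero).1 h
      exact mul_left_cancel₀ hd0 (by rw [this, mul_one])
    have a2 : AnalyticAt ℂ (fun s => xi ((d + 1) * s)) s :=
      AnalyticAt.fun_comp (analyticAt_xi h0 h1) (by fun_prop)
    exact ((analyticAt_ofReal_cpow hD analyticAt_id).mul a1).div a2 hxi
  refine meromorphicContinuation_eq (G := fun s => ((|g.det| : ℝ) : ℂ) ^ s * Λ ((d + 1) * s / 2) / xi ((d + 1) * s))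
    ?_ ?_ ?_ (hGa s h0 h1 hs1 hxi)
  · intro s _
    have a1 : MeromorphicAt (fun s => Λ ((d + 1) * s / 2)) s :=
      (hmer _ (Set.mem_univ _)).comp_analyticAt (f := Λ) (g := fun s => ((d : ℂ) + 1) * s / 2) (by fun_prop)
    have a2 : MeromorphicAt (fun s => xi ((d + 1) * s)) s :=
      (meromorphicOn_xi _ (Set.mem_univ _)).comp_analyticAt (f := xi) (g := fun s => ((d : ℂ) + 1) * s)
        (by fun_prop)
    exact ((analyticAt_ofReal_cpow hD analyticAt_id).meromorphicAt.mul a1).div a2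
  all_goals
    intro s hs
    have hre : (((d + 1) * s : ℂ)).re = (d + 1) * s.re := by
      rw [show ((d : ℂ) + 1) = ((d + 1 : ℝ) : ℂ) by push_cast; rfl, re_ofReal_mul]
    have hd1 : (1 : ℝ) ≤ d := by exact_mod_cast hd
    have hre1 : 1 < (((d + 1) * s : ℂ)).re := by rw [hre]; nlinarith
    have hxi' := xi_ne_zero_of_one_lt_re hre1
  · refine hGa s ?_ ?_ ?_ hxi'
    · intro h; rw [h] at hre1; simp at hre1; linarith
    · intro h; rw [h] at hre1; simp at hre1
    · rintro rfl; simp at hs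
  · rw [div_eq_iff hxi', eisensteinSeries_mul_xi hd hdet hs, (hmel _ ?_).2]
    rw [div_ofNat_re, hre]
    nlinarith

end LeviContinuation

/-! ### The integral defining the K-Bessel function -/

section BesselKernel

open Filter Topology Asymptotics

theorem exp_le_factorial_div_pow {y : ℝ} (hy : 0 < y) (N : ℕ) :
    Real.exp (-y) ≤ N.factorial / y ^ N := by
  rw [Real.exp_neg, inv_eq_one_div, div_le_div_iff₀ (Real.exp_pos _) (by positivity), one_mul,
    ← div_le_iff₀' (by positivity)]
  exact Real.pow_div_factorial_le_exp _ hy.le _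

/-- Half of the exponent is bounded by the inequality of arithmetic and geometric means, giving
decay in (Q, j) for summation; the other half gives a majorant in t alone, independent of the index,
for integration. -/
theorem exp_neg_quadratic_le {c Q t j : ℝ} (hc : 0 < c) (hQ : c ≤ Q) (ht : 0 < t) (hj : 1 ≤ j) :
    Real.exp (-Real.pi * (Q * t + j ^ 2 / t)) ≤
      Real.exp (-(Real.pi * √Q * j)) * Real.exp (-Real.pi * (c * t + 1 / t) / 2) := by
  rw [← Real.exp_add, Real.exp_le_exp]
  have hQ0 : 0 ≤ Q := hc.le.trans hQ
  have h1 : 2 * √Q * j ≤ Q * t + j ^ 2 / t := by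
    have h := sq_nonneg (√Q * t - j)
    have h2 : Q * t + j ^ 2 / t - 2 * √Q * j = (√Q * t - j) ^ 2 / t := by
      field_simp
      have := Real.sq_sqrt hQ0
      linear_combination -t ^ 2 * this
    have : 0 ≤ (√Q * t - j) ^ 2 / t := by positivity
    linarith
  have h3 : c * t + 1 / t ≤ Q * t + j ^ 2 / t := by
    have : 1 ≤ j ^ 2 := one_le_pow₀ hj
    have h5 : c * t ≤ Q * t := mul_le_mul_of_nonneg_right hQ ht.le
    have : 1 / t ≤ j ^ 2 / t := div_le_div_of_nonneg_right this ht.le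
    linarith
  have := Real.pi_pos
  nlinarith [mul_le_mul_of_nonneg_left h1 this.le, mul_le_mul_of_nonneg_left h3 this.le]

theorem mellinConvergent_exp_neg_add_inv {c : ℝ} (hc : 0 < c) (w : ℂ) :
    MellinConvergent (fun t : ℝ => ((Real.exp (-Real.pi * (c * t + 1 / t) / 2) : ℝ) : ℂ)) w := by
  have hπ := Real.pi_pos
  refine mellinConvergent_of_isBigO_rpow_exp (a := Real.pi * c / 2) (b := w.re - 1) (by positivity)
    ?_ ?_ ?_ (by linarith)
  · refine ContinuousOn.locallyIntegrableOn ?_ measurableSet_Ioi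
    refine continuous_ofReal.comp_continuousOn (Real.continuous_exp.comp_continuousOn ?_)
    refine ContinuousOn.div_const (ContinuousOn.mul continuousOn_const
      (ContinuousOn.add (by fun_prop) ?_)) _
    exact continuousOn_const.div continuousOn_id fun t ht => ne_of_gt ht
  · refine IsBigO.of_bound 1 ?_
    filter_upwards [eventually_gt_atTop 0] with t ht
    rw [norm_real, Real.norm_of_nonneg (Real.exp_pos _).le, Real.norm_of_nonneg (Real.exp_pos _).le,
      one_mul, Real.exp_le_exp]
    have : 0 < 1 / t := by positivity
    nlinarith [mul_pos hπ this]
  · have h1 := (isLittleO_exp_neg_mul_rpow_atTop (a := Real.pi / 2) (by positivity)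
      (w.re - 1)).isBigO.comp_tendsto tendsto_inv_nhdsGT_zero
    refine IsBigO.trans (IsBigO.of_bound 1 ?_) (h1.congr' EventuallyEq.rfl ?_)
    · filter_upwards [self_mem_nhdsWithin] with t ht
      have ht : 0 < t := ht
      rw [Function.comp_apply, norm_real, Real.norm_of_nonneg (Real.exp_pos _).le, Real.norm_of_nonneg (Real.exp_pos _).le,
        one_mul, Real.exp_le_exp, one_div]
      have : 0 < c * t := by positivity
      nlinarith [mul_pos hπ this]
    · filter_upwards [self_mem_nhdsWithin] with t ht
      have ht : 0 < t := ht
      rw [Function.comp_apply, Real.inv_rpow ht.le, Real.rpow_neg ht.le]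

/-- Scaling t by j/√Q makes the exponent a multiple of t + 1/t. -/
theorem mellin_exp_eq_besselK {Q j : ℝ} (hQ : 0 < Q) (hj : 0 < j) (ν : ℂ) :
    mellin (fun t : ℝ => ((Real.exp (-Real.pi * (Q * t + j ^ 2 / t)) : ℝ) : ℂ)) ν =
      2 * ((j / √Q : ℝ) : ℂ) ^ ν * besselK ν (2 * Real.pi * (j * √Q)) := by
  have hs : 0 < √Q := Real.sqrt_pos.2 hQ
  have hl : 0 < (j / √Q)⁻¹ := by positivity
  have h := mellin_comp_mul_left
    (fun t : ℝ => ((Real.exp (-(2 * Real.pi * (j * √Q)) * (t + t⁻¹) / 2) : ℝ) : ℂ)) ν hl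
  have hfun : (fun t : ℝ => ((Real.exp (-Real.pi * (Q * t + j ^ 2 / t)) : ℝ) : ℂ)) =
      fun t : ℝ => ((Real.exp (-(2 * Real.pi * (j * √Q)) * ((j / √Q)⁻¹ * t + ((j / √Q)⁻¹ * t)⁻¹) / 2) : ℝ) : ℂ) := by
    ext t
    congr 2
    rw [mul_inv, inv_inv]
    have h2 := Real.sq_sqrt hQ.le
    by_cases ht : t = 0
    · simp [ht]
    · field_simp
      linear_combination (t ^ 2) * h2
  rw [hfun, h, besselK, mellin, cpow_neg, ofReal_inv, inv_cpow _ _ (by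
    rw [arg_ofReal_of_nonneg (by positivity)]; exact Real.pi_pos.ne), inv_inv, smul_eq_mul]
  simp only [smul_eq_mul, mul_comm]
  ring

end BesselKernel

/-! ### The rapidly decaying part of the theta series as a sum of characters -/

section Remainder

open Filter Topology Asymptotics HurwitzZeta Matrix

/-- The upper left block of a matrix. -/
abbrev block {k : ℕ} (z : Matrix (Fin (k + 1)) (Fin (k + 1)) ℝ) : Matrix (Fin k) (Fin k) ℝ :=
  z.submatrix Fin.castSucc Fin.castSucc

/-- The pairing of `c` with the last column of `z`. -/
def pairing {k : ℕ} (z : Matrix (Fin (k + 1)) (Fin (k + 1)) ℝ) (c : Fin k → ℤ) : ℝ :=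
  ∑ i, (c i : ℝ) * z i.castSucc (Fin.last k)

theorem pairing_smul {k : ℕ} (z : Matrix (Fin (k + 1)) (Fin (k + 1)) ℝ) (m : ℤ) (c : Fin k → ℤ) :
    pairing z (m • c) = m * pairing z c := by
  simp [pairing, Finset.mul_sum, mul_assoc]

theorem pairing_neg {k : ℕ} (z : Matrix (Fin (k + 1)) (Fin (k + 1)) ℝ) (c : Fin k → ℤ) :
    pairing z (-c) = -pairing z c := by
  simp [pairing]

theorem quad_neg {k : ℕ} (g : Matrix (Fin k) (Fin k) ℝ) (c : Fin k → ℤ) :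
    quad g (-c) = quad g c := by
  simp [quad]

/-- The part of the theta function of `z` which decays rapidly at `0` and at infinity. -/
def remainder {k : ℕ} (z : Matrix (Fin (k + 1)) (Fin (k + 1)) ℝ) (t : ℝ) : ℝ :=
  theta z t - evenKernel (0 : ℝ) t - t ^ (-(1 / 2) : ℝ) * (theta (block z) t - 1)

/-- A matrix with last row `(0, …, 0, 1)` which is invertible. -/
structure IsAffine {k : ℕ} (z : Matrix (Fin (k + 1)) (Fin (k + 1)) ℝ) : Prop where
  row_zero : ∀ j : Fin k, z (Fin.last k) j.castSucc = 0
  row_one : z (Fin.last k) (Fin.last k) = 1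
  det_ne : z.det ≠ 0
  block_det_ne : (block z).det ≠ 0

theorem summable_exp_neg_sqrt_quad {k : ℕ} {g : Matrix (Fin k) (Fin k) ℝ} (hg : g.det ≠ 0) :
    Summable fun i : {c : Fin k → ℤ // c ≠ 0} × ℕ+ =>
      Real.exp (-(Real.pi * √(quad g i.1) * ((i.2 : ℕ) : ℝ))) := by
  -- The power k + 2 serves both sums: Q^{-(k+2)/2} converges over ℤ^k without 0, and j^{-(k+2)}
  -- over the positive integers.
  have h1 : Summable fun c : {c : Fin k → ℤ // c ≠ 0} => quad g c ^ (-((k + 2 : ℕ) / 2 : ℝ)) :=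
    (summable_quad_rpow hg (σ := (k + 2 : ℕ) / 2) (by push_cast; linarith)).comp_injective
      Subtype.val_injective
  have h2 : Summable fun j : ℕ+ => 1 / ((j : ℕ) : ℝ) ^ (k + 2) :=
    (Real.summable_one_div_nat_pow.2 (by omega)).comp_injective PNat.coe_injective
  have h3 := (h1.mul_of_nonneg h2 (fun _ => Real.rpow_nonneg (quad_nonneg _ _) _)
    (fun _ => by positivity)).mul_left ((k + 2).factorial / Real.pi ^ (k + 2) : ℝ)
  refine Summable.of_nonneg_of_le (fun _ => (Real.exp_pos _).le) (fun i => ?_) h3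
  have hQ := quad_pos hg i.1.2
  have hs := Real.sqrt_pos.2 hQ
  have hj : (0 : ℝ) < ((i.2 : ℕ) : ℝ) := by exact_mod_cast i.2.pos
  refine (exp_le_factorial_div_pow (by positivity) (k + 2)).trans (le_of_eq ?_)
  rw [mul_pow, mul_pow, Real.rpow_neg hQ.le, Real.sqrt_eq_rpow, ← Real.rpow_natCast (_ ^ _),
    ← Real.rpow_mul hQ.le, one_div_mul_eq_div]
  field_simp

variable {k : ℕ} {z : Matrix (Fin (k + 1)) (Fin (k + 1)) ℝ}

theorem IsAffine.exp_le (hz : IsAffine z) : ∃ c > 0, ∀ (i : {c : Fin k → ℤ // c ≠ 0} × ℕ+) (t : ℝ),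
    0 < t → Real.exp (-Real.pi * (quad (block z) i.1 * t + ((i.2 : ℕ) : ℝ) ^ 2 / t)) ≤
      Real.exp (-(Real.pi * √(quad (block z) i.1) * ((i.2 : ℕ) : ℝ))) *
        Real.exp (-Real.pi * (c * t + 1 / t) / 2) := by
  obtain ⟨c, hc, h⟩ := exists_le_quad _ hz.block_det_ne
  exact ⟨c, hc, fun i t ht => exp_neg_quadratic_le hc (h _ i.1.2) ht (by exact_mod_cast one_le (a := i.2))⟩

theorem hasSum_pnat_cosKernel (β : ℝ) {x : ℝ} (hx : 0 < x) :
    HasSum (fun j : ℕ+ => 2 * Real.cos (2 * Real.pi * β * ((j : ℕ) : ℝ)) *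
      Real.exp (-Real.pi * ((j : ℕ) : ℝ) ^ 2 * x)) (cosKernel β x - 1) := by
  have := hasSum_nat_cosKernel₀ β hx
  refine (Equiv.pnatEquivNat.symm.hasSum_iff (f := fun j : ℕ+ =>
    2 * Real.cos (2 * Real.pi * β * ((j : ℕ) : ℝ)) *
      Real.exp (-Real.pi * ((j : ℕ) : ℝ) ^ 2 * x))).1 (this.congr_fun fun n => ?_)
  simp [Equiv.pnatEquivNat]

/-- The term c = 0 cancels the one-dimensional theta series, and the constant term 1 of each
`cosKernel` cancels t^{-1/2}(θ_M - 1). -/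
theorem IsAffine.hasSum_remainder_block (hz : IsAffine z) {t : ℝ} (ht : 0 < t) :
    HasSum (fun c : {c : Fin k → ℤ // c ≠ 0} => t ^ (-(1 / 2) : ℝ) *
      Real.exp (-Real.pi * quad (block z) c * t) * (cosKernel (pairing z c) (1 / t) - 1))
      (remainder z t) := by
  classical
  have h1 := theta_succ hz.det_ne hz.row_zero (by rw [hz.row_one]; exact one_ne_zero) ht
  simp only [hz.row_one, div_one, one_pow, one_mul] at h1
  have h2 := (hasSum_theta_sub_one hz.block_det_ne ht).mul_left (t ^ (-(1 / 2) : ℝ))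
  have h3 := hasSum_ite_eq (0 : Fin k → ℤ) (evenKernel (0 : ℝ) t)
  have h4 := (h1.sub h3).sub h2
  have h5 := (hasSum_subtype_iff_of_support_subset (s := {c : Fin k → ℤ | c ≠ 0}) (fun c hc => by
    rintro rfl
    simp at hc)).2 h4
  refine HasSum.congr_fun h5 fun c => ?_
  have hc : (c : Fin k → ℤ) ≠ 0 := c.2
  simp only [Function.comp_apply, if_neg hc, sub_zero]
  rw [evenKernel_functional_equation, Real.rpow_neg ht.le, one_div (t ^ _)]
  change _ = Real.exp _ * (_ * cosKernel (pairing z c : ℝ) _) - _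
  ring

/-- The summands of `remainder`. -/
def remainderTerm (z : Matrix (Fin (k + 1)) (Fin (k + 1)) ℝ) (t : ℝ)
    (i : {c : Fin k → ℤ // c ≠ 0} × ℕ+) : ℂ :=
  cexp (2 * Real.pi * I * (((i.2 : ℕ) : ℝ) * pairing z i.1 : ℝ)) *
    (t ^ (-(1 / 2) : ℝ) *
      Real.exp (-Real.pi * (quad (block z) i.1 * t + ((i.2 : ℕ) : ℝ) ^ 2 / t)) : ℝ)

theorem norm_cexp_two_pi_mul (x : ℝ) : ‖cexp (2 * Real.pi * I * x)‖ = 1 := by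
  rw [show (2 * Real.pi * I * x : ℂ) = ((2 * Real.pi * x : ℝ) : ℂ) * I by push_cast; ring,
    norm_exp_ofReal_mul_I]

theorem norm_remainderTerm (z : Matrix (Fin (k + 1)) (Fin (k + 1)) ℝ) {t : ℝ} (ht : 0 < t)
    (i : {c : Fin k → ℤ // c ≠ 0} × ℕ+) :
    ‖remainderTerm z t i‖ = t ^ (-(1 / 2) : ℝ) *
      Real.exp (-Real.pi * (quad (block z) i.1 * t + ((i.2 : ℕ) : ℝ) ^ 2 / t)) := by
  rw [remainderTerm, norm_mul, norm_cexp_two_pi_mul, one_mul, norm_real,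
    Real.norm_of_nonneg (by positivity)]

theorem IsAffine.summable_remainderTerm (hz : IsAffine z) {t : ℝ} (ht : 0 < t) :
    Summable (remainderTerm z t) := by
  obtain ⟨c, hc, h⟩ := hz.exp_le
  refine Summable.of_norm_bounded (((summable_exp_neg_sqrt_quad hz.block_det_ne).mul_right
    (Real.exp (-Real.pi * (c * t + 1 / t) / 2))).mul_left (t ^ (-(1 / 2) : ℝ))) fun i => ?_
  rw [norm_remainderTerm z ht]
  exact mul_le_mul_of_nonneg_left (h i t ht) (by positivity)

theorem IsAffine.hasSum_remainder (hz : IsAffine z) {t : ℝ} (ht : 0 < t) :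
    HasSum (fun i => 2 * remainderTerm z t i) (remainder z t : ℂ) := by
  have hs := hz.summable_remainderTerm ht
  -- The involution c ↦ -c preserves the quadratic form and conjugates the character, so pairing c
  -- with -c turns exponentials into the cosines of `cosKernel`.
  let σ : {c : Fin k → ℤ // c ≠ 0} × ℕ+ ≃ {c : Fin k → ℤ // c ≠ 0} × ℕ+ :=
    Equiv.prodCongr ⟨fun c => ⟨-c, neg_ne_zero.2 c.2⟩, fun c => ⟨-c, neg_ne_zero.2 c.2⟩,
      fun c => by simp, fun c => by simp⟩ (Equiv.refl _)
  have h1 := hs.hasSum.add (σ.hasSum_iff.2 hs.hasSum)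
  have h2 := h1.prod_fiberwise (g := fun c : {c : Fin k → ℤ // c ≠ 0} =>
    ((t ^ (-(1 / 2) : ℝ) * Real.exp (-Real.pi * quad (block z) c * t) *
      (cosKernel (pairing z c) (1 / t) - 1) : ℝ) : ℂ)) fun c => by
    have h3 := hasSum_ofReal.2 ((hasSum_pnat_cosKernel (pairing z c) (one_div_pos.2 ht)).mul_left
      (t ^ (-(1 / 2) : ℝ) * Real.exp (-Real.pi * quad (block z) c * t)))
    refine h3.congr_fun fun j => ?_
    change cexp (2 * Real.pi * I * (((j : ℕ) : ℝ) * pairing z c : ℝ)) * _ +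
      cexp (2 * Real.pi * I * (((j : ℕ) : ℝ) * pairing z (-c) : ℝ)) *
        (t ^ (-(1 / 2) : ℝ) * Real.exp (-Real.pi * (quad (block z) (-c) * t + ((j : ℕ) : ℝ) ^ 2 / t)) : ℝ) = _
    rw [quad_neg, pairing_neg, ← add_mul]
    have e1 : cexp (2 * Real.pi * I * (((j : ℕ) : ℝ) * pairing z c : ℝ)) +
        cexp (2 * Real.pi * I * (((j : ℕ) : ℝ) * -pairing z c : ℝ)) =
        ((2 * Real.cos (2 * Real.pi * pairing z c * ((j : ℕ) : ℝ)) : ℝ) : ℂ) := by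
      rw [ofReal_mul 2, ofReal_cos, ofReal_ofNat, two_cos]
      congr 2 <;> (push_cast; ring)
    have e2 : Real.exp (-Real.pi * (quad (block z) c * t + ((j : ℕ) : ℝ) ^ 2 / t)) =
        Real.exp (-Real.pi * quad (block z) c * t) *
          Real.exp (-Real.pi * ((j : ℕ) : ℝ) ^ 2 * (1 / t)) := by
      rw [← Real.exp_add]; congr 1; field_simp; ring
    rw [e1, ← ofReal_mul]
    simp only
    rw [e2]
    congr 1
    ring
  have h3 := hasSum_ofReal.2 (hz.hasSum_remainder_block ht)
  have h4 := h2.unique h3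
  rw [← h4, ← two_mul]
  exact hs.hasSum.mul_left 2

end Remainder

/-! ### Mellin transforms of the three parts of the theta series -/

section RemainderMellin

open Filter Topology Asymptotics HurwitzZeta Matrix

variable {k : ℕ} {z : Matrix (Fin (k + 1)) (Fin (k + 1)) ℝ}

theorem hasMellin_evenKernel_zero {w : ℂ} (hw : 1 / 2 < w.re) :
    HasMellin (fun t => ((evenKernel (0 : ℝ) t - 1 : ℝ) : ℂ)) w (2 * xi (2 * w)) := by
  have h := (hurwitzEvenFEPair 0).hasMellin (s := w) hw
  have h1 : 2 * xi (2 * w) = (hurwitzEvenFEPair 0).Λ w := by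
    rw [xi, completedRiemannZeta, completedHurwitzZetaEven, mul_div_cancel₀ _ (two_ne_zero' ℂ),
      mul_div_cancel_left₀ _ (two_ne_zero' ℂ)]
  rw [h1]
  convert! h using 1
  ext t
  simp [hurwitzEvenFEPair]

theorem continuousOn_rpow_neg_half : ContinuousOn (fun t : ℝ => t ^ (-(1 / 2) : ℝ)) (Set.Ioi 0) :=
  fun _ ht => (Real.continuousAt_rpow_const _ _ (Or.inl (ne_of_gt ht))).continuousWithinAt

theorem IsAffine.continuousOn_remainder (hz : IsAffine z) :
    ContinuousOn (remainder z) (Set.Ioi 0) :=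
  ((continuousOn_theta hz.det_ne).sub (continuousOn_evenKernel _)).sub
    (continuousOn_rpow_neg_half.mul ((continuousOn_theta hz.block_det_ne).sub continuousOn_const))

theorem IsAffine.norm_remainder_le (hz : IsAffine z) : ∃ c > 0, ∃ S : ℝ, ∀ t : ℝ, 0 < t →
    ‖remainder z t‖ ≤ S * (t ^ (-(1 / 2) : ℝ) * Real.exp (-Real.pi * (c * t + 1 / t) / 2)) := by
  obtain ⟨c, hc, h⟩ := hz.exp_le
  have hb := summable_exp_neg_sqrt_quad hz.block_det_ne
  refine ⟨c, hc, 2 * ∑' i : {c : Fin k → ℤ // c ≠ 0} × ℕ+,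
    Real.exp (-(Real.pi * √(quad (block z) i.1) * ((i.2 : ℕ) : ℝ))), fun t ht => ?_⟩
  rw [← norm_real, ← (hz.hasSum_remainder ht).tsum_eq]
  refine tsum_of_norm_bounded ((hb.hasSum.mul_left 2).mul_right _) fun i => ?_
  rw [norm_mul, norm_remainderTerm z ht, RCLike.norm_ofNat, mul_assoc]
  have := mul_le_mul_of_nonneg_left (h i t ht) (Real.rpow_nonneg ht.le (-(1 / 2)))
  linarith

theorem IsAffine.remainder_isBigO_top (hz : IsAffine z) (a : ℝ) :
    (fun t => (remainder z t : ℂ)) =O[atTop] fun t : ℝ => t ^ (-a) := by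
  obtain ⟨c, hc, S, h⟩ := hz.norm_remainder_le
  have h1 := (isLittleO_exp_neg_mul_rpow_atTop (a := Real.pi * c / 2) (by positivity) (-a)).isBigO
  refine isBigO_ofReal (IsBigO.trans (IsBigO.of_bound |S| ?_) h1)
  filter_upwards [eventually_ge_atTop 1] with t ht
  have ht0 : 0 < t := by linarith
  refine (h t ht0).trans ((mul_le_mul_of_nonneg_right (le_abs_self S) (by positivity)).trans ?_)
  refine mul_le_mul_of_nonneg_left ?_ (abs_nonneg _)
  rw [Real.norm_of_nonneg (Real.exp_pos _).le]
  refine (mul_le_of_le_one_left (Real.exp_pos _).le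
    (Real.rpow_le_one_of_one_le_of_nonpos ht (by norm_num))).trans ?_
  rw [Real.exp_le_exp]
  have : 0 < 1 / t := by positivity
  nlinarith [mul_pos Real.pi_pos this]

theorem IsAffine.remainder_isBigO_zero (hz : IsAffine z) (b : ℝ) :
    (fun t => (remainder z t : ℂ)) =O[𝓝[>] 0] fun t : ℝ => t ^ (-b) := by
  obtain ⟨c, hc, S, h⟩ := hz.norm_remainder_le
  have h1 := (isLittleO_exp_neg_mul_rpow_atTop (a := Real.pi / 2) (by positivity)
      (b - 1 / 2)).isBigO.comp_tendsto tendsto_inv_nhdsGT_zero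
  have h2 := (isBigO_refl (fun t : ℝ => t ^ (-(1 / 2) : ℝ)) (𝓝[>] 0)).mul h1
  refine isBigO_ofReal (IsBigO.trans (IsBigO.of_bound |S| ?_) (h2.congr' EventuallyEq.rfl ?_))
  · filter_upwards [self_mem_nhdsWithin] with t ht
    have ht : 0 < t := ht
    refine (h t ht).trans ((mul_le_mul_of_nonneg_right (le_abs_self S) (by positivity)).trans ?_)
    refine mul_le_mul_of_nonneg_left ?_ (abs_nonneg _)
    rw [Function.comp_apply, Real.norm_of_nonneg (by positivity)]
    refine mul_le_mul_of_nonneg_left ?_ (by positivity)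
    rw [Real.exp_le_exp, one_div]
    have : 0 < c * t := by positivity
    nlinarith [mul_pos Real.pi_pos this]
  · filter_upwards [self_mem_nhdsWithin] with t ht
    have ht : 0 < t := ht
    rw [Function.comp_apply, Real.inv_rpow ht.le, ← Real.rpow_neg ht.le, ← Real.rpow_add ht]
    congr 1; ring

theorem IsAffine.locallyIntegrableOn_remainder (hz : IsAffine z) :
    LocallyIntegrableOn (fun t => (remainder z t : ℂ)) (Set.Ioi 0) :=
  (continuous_ofReal.comp_continuousOn hz.continuousOn_remainder).locallyIntegrableOn
    measurableSet_Ioi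

theorem IsAffine.mellinConvergent_remainder (hz : IsAffine z) (w : ℂ) :
    MellinConvergent (fun t => (remainder z t : ℂ)) w :=
  mellinConvergent_of_isBigO_rpow hz.locallyIntegrableOn_remainder
    (hz.remainder_isBigO_top (w.re + 1)) (by linarith) (hz.remainder_isBigO_zero (w.re - 1))
    (by linarith)

theorem IsAffine.differentiable_mellin_remainder (hz : IsAffine z) :
    Differentiable ℂ (mellin fun t => (remainder z t : ℂ)) := fun w =>
  mellin_differentiableAt_of_isBigO_rpow hz.locallyIntegrableOn_remainder
    (hz.remainder_isBigO_top (w.re + 1)) (by linarith) (hz.remainder_isBigO_zero (w.re - 1))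
    (by linarith)

/-- The factor t^{-1/2} in front of θ_M - 1 shifts the Mellin variable by 1/2, which is why the Levi
series appears at a shifted argument. -/
theorem IsAffine.mellin_theta (hz : IsAffine z) {w L : ℂ} (hw : 1 / 2 < w.re)
    (hL : HasMellin (fun t => ((theta (block z) t - 1 : ℝ) : ℂ)) (w - 1 / 2) L) :
    mellin (fun t => ((theta z t - 1 : ℝ) : ℂ)) w =
      2 * xi (2 * w) + L + mellin (fun t => (remainder z t : ℂ)) w := by
  have h1 := hasMellin_evenKernel_zero hw
  have h2 : MellinConvergent (fun t : ℝ => (t : ℂ) ^ (-(1 / 2) : ℂ) • ((theta (block z) t - 1 : ℝ) : ℂ)) w := by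
    rw [MellinConvergent.cpow_smul]; exact hL.1
  have h2' : mellin (fun t : ℝ => (t : ℂ) ^ (-(1 / 2) : ℂ) • ((theta (block z) t - 1 : ℝ) : ℂ)) w = L := by
    rw [mellin_cpow_smul]; exact hL.2
  have h3 := hasMellin_add h1.1 h2
  have h4 := hasMellin_add h3.1 (hz.mellinConvergent_remainder w)
  rw [h3.2, h1.2, h2'] at h4
  rw [← h4.2, mellin, mellin]
  refine setIntegral_congr_fun measurableSet_Ioi fun t ht => ?_
  have ht : 0 < t := ht
  simp only [smul_eq_mul, remainder]
  congr 1
  have : ((t ^ (-(1 / 2) : ℝ) : ℝ) : ℂ) = (t : ℂ) ^ (-(1 / 2) : ℂ) := by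
    rw [ofReal_cpow ht.le]; push_cast; rfl
  push_cast [this]
  ring

theorem cpow_mul_remainderTerm {t : ℝ} (ht : 0 < t) (w : ℂ)
    (i : {c : Fin k → ℤ // c ≠ 0} × ℕ+) :
    (t : ℂ) ^ (w - 1) * remainderTerm z t i =
      cexp (2 * Real.pi * I * (((i.2 : ℕ) : ℝ) * pairing z i.1 : ℝ)) *
        ((t : ℂ) ^ (w - 1 / 2 - 1) *
          (Real.exp (-Real.pi * (quad (block z) i.1 * t + ((i.2 : ℕ) : ℝ) ^ 2 / t)) : ℝ)) := by
  have h : (t : ℂ) ^ (w - 1 / 2 - 1) = (t : ℂ) ^ (w - 1) * ((t ^ (-(1 / 2) : ℝ) : ℝ) : ℂ) := by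
    rw [ofReal_cpow ht.le, ← cpow_add _ _ (by exact_mod_cast ht.ne')]
    congr 1; push_cast; ring
  rw [remainderTerm, h, ofReal_mul (t ^ (-(1 / 2) : ℝ))]
  ring

/-- Sum and integral may be interchanged because `IsAffine.exp_le` majorises each term by a summable
factor times one fixed integrable function H. -/
theorem IsAffine.hasSum_mellin_remainder (hz : IsAffine z) (w : ℂ) :
    HasSum (fun i : {c : Fin k → ℤ // c ≠ 0} × ℕ+ =>
      2 * (cexp (2 * Real.pi * I * (((i.2 : ℕ) : ℝ) * pairing z i.1 : ℝ)) *
        (2 * ((((i.2 : ℕ) : ℝ) / √(quad (block z) i.1) : ℝ) : ℂ) ^ (w - 1 / 2) *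
          besselK (w - 1 / 2) (2 * Real.pi * (((i.2 : ℕ) : ℝ) * √(quad (block z) i.1))))))
      (mellin (fun t => (remainder z t : ℂ)) w) := by
  obtain ⟨c, hc, h⟩ := hz.exp_le
  have hb := summable_exp_neg_sqrt_quad hz.block_det_ne
  have hH := mellinConvergent_exp_neg_add_inv hc (w - 1 / 2)
  set H : ℝ → ℂ := fun t => (t : ℂ) ^ (w - 1 / 2 - 1) •
    ((Real.exp (-Real.pi * (c * t + 1 / t) / 2) : ℝ) : ℂ) with hHdef
  set f : {c : Fin k → ℤ // c ≠ 0} × ℕ+ → ℝ → ℂ := fun i t =>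
    2 * (cexp (2 * Real.pi * I * (((i.2 : ℕ) : ℝ) * pairing z i.1 : ℝ)) *
        ((t : ℂ) ^ (w - 1 / 2 - 1) *
          (Real.exp (-Real.pi * (quad (block z) i.1 * t + ((i.2 : ℕ) : ℝ) ^ 2 / t)) : ℝ))) with hf
  have hle : ∀ i, ∀ t ∈ Set.Ioi (0 : ℝ), ‖f i t‖ ≤
      2 * Real.exp (-(Real.pi * √(quad (block z) i.1) * ((i.2 : ℕ) : ℝ))) * ‖H t‖ := by
    intro i t ht
    simp only [hf, hHdef, norm_mul, norm_smul, norm_cexp_two_pi_mul, one_mul, RCLike.norm_ofNat,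
      norm_real, Real.norm_of_nonneg (Real.exp_pos _).le]
    have := mul_le_mul_of_nonneg_left (h i t ht) (norm_nonneg ((t : ℂ) ^ (w - 1 / 2 - 1)))
    linarith
  have hmeas : ∀ i, AEStronglyMeasurable (f i) (volume.restrict (Set.Ioi 0)) := by
    intro i
    refine ContinuousOn.aestronglyMeasurable ?_ measurableSet_Ioi
    refine continuousOn_const.mul (continuousOn_const.mul (ContinuousOn.mul ?_ ?_))
    · intro t ht
      exact (continuousAt_ofReal_cpow_const _ _ (Or.inr (ne_of_gt ht))).continuousWithinAt
    · refine continuous_ofReal.comp_continuousOn (Real.continuous_exp.comp_continuousOn ?_)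
      refine continuousOn_const.mul (ContinuousOn.add (by fun_prop) ?_)
      exact continuousOn_const.div continuousOn_id fun t ht => ne_of_gt ht
  have hHn : Integrable (fun t => ‖H t‖) (volume.restrict (Set.Ioi 0)) := Integrable.norm hH
  have hint : ∀ i, Integrable (f i) (volume.restrict (Set.Ioi 0)) := fun i =>
    (hHn.const_mul _).mono' (hmeas i) ((ae_restrict_iff' measurableSet_Ioi).2
      (Filter.Eventually.of_forall (hle i)))
  have hsum := hasSum_integral_of_summable_integral_norm hint (by
    refine Summable.of_nonneg_of_le (fun i => integral_nonneg fun _ => norm_nonneg _) (fun i => ?_)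
      ((hb.mul_left 2).mul_right (∫ t in Set.Ioi 0, ‖H t‖))
    rw [← integral_const_mul]
    refine integral_mono_ae (hint i).norm (hHn.const_mul _) ((ae_restrict_iff' measurableSet_Ioi).2
      (Filter.Eventually.of_forall (hle i))))
  have hval : ∫ t in Set.Ioi (0 : ℝ), ∑' i, f i t = mellin (fun t => (remainder z t : ℂ)) w := by
    rw [mellin]
    refine setIntegral_congr_fun measurableSet_Ioi fun t ht => ?_
    simp only [smul_eq_mul]
    rw [← (hz.hasSum_remainder ht).tsum_eq, ← tsum_mul_left]
    refine tsum_congr fun i => ?_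
    simp only [hf]
    rw [← cpow_mul_remainderTerm ht]
    ring
  rw [hval] at hsum
  refine hsum.congr_fun fun i => ?_
  rw [← mellin_exp_eq_besselK (quad_pos hz.block_det_ne i.1.2) (by exact_mod_cast i.2.pos)]
  simp only [hf]
  rw [integral_const_mul, integral_const_mul]
  rfl

end RemainderMellin

/-! ### Collecting terms of equal frequency; divisor sums -/

section Reindex

/-- Triples `((l, q), j)` parametrised by `(j * l, q)` and the factorisations of `j * l`. -/
def divisorEquiv (α : Type*) :
    (Σ p : ℕ+ × α, Nat.divisorsAntidiagonal p.1) ≃ (ℕ+ × α) × ℕ+ where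
  toFun x := (((sigmaAntidiagonalEquivProd ⟨x.1.1, x.2⟩).2, x.1.2),
    (sigmaAntidiagonalEquivProd ⟨x.1.1, x.2⟩).1)
  invFun y := ⟨((sigmaAntidiagonalEquivProd.symm (y.2, y.1.1)).1, y.1.2),
    (sigmaAntidiagonalEquivProd.symm (y.2, y.1.1)).2⟩
  left_inv x := by
    have h := sigmaAntidiagonalEquivProd.symm_apply_apply ⟨x.1.1, x.2⟩
    obtain ⟨⟨m, q⟩, x⟩ := x
    simp only
    generalize sigmaAntidiagonalEquivProd.symm (sigmaAntidiagonalEquivProd ⟨m, x⟩) = u at h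
    subst h
    rfl
  right_inv y := by simp

/-- For a factorisation m = ac one has a/c = m c⁻². -/
theorem sum_divisorsAntidiagonal_div_cpow {m : ℕ} (hm : m ≠ 0) (ν : ℂ) :
    ∑ x ∈ m.divisorsAntidiagonal, (((x.1 : ℝ) / (x.2 : ℝ) : ℝ) : ℂ) ^ ν =
      (m : ℂ) ^ ν * sigma (-2 * ν) m := by
  rw [sigma, Finset.mul_sum,
    Nat.sum_divisorsAntidiagonal' (f := fun a b => (((a : ℝ) / (b : ℝ) : ℝ) : ℂ) ^ ν)]
  refine Finset.sum_congr rfl fun c hc => ?_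
  have hc' := Nat.dvd_of_mem_divisors hc
  have hc0 : 0 < c := Nat.pos_of_mem_divisors hc
  have hcr : (0 : ℝ) < c := by exact_mod_cast hc0
  have hmr : (0 : ℝ) < m := by exact_mod_cast Nat.pos_of_ne_zero hm
  rw [Nat.cast_div hc' hcr.ne']
  have : ((m : ℝ) / c / c) = m * ((c : ℝ) ^ 2)⁻¹ := by field_simp
  rw [this, ofReal_mul, mul_cpow_ofReal_nonneg hmr.le (by positivity), ofReal_natCast]
  congr 1
  rw [← ofReal_natCast, cpow_def_of_ne_zero (by exact_mod_cast (inv_pos.2 (pow_pos hcr 2)).ne'),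
    cpow_def_of_ne_zero (by exact_mod_cast hcr.ne'), ← ofReal_log (by positivity),
    ← ofReal_log hcr.le, Real.log_inv, Real.log_pow]
  congr 1; push_cast; ring

/-- The Fourier coefficients of the nonconstant part of the Eisenstein series. -/
def besselCoeff {d : ℕ} (M : Matrix (Fin (d + 1)) (Fin (d + 1)) ℝ) (ν : ℂ) (p : ℕ+ × Cosets d) : ℂ :=
  4 * (((p.1 : ℕ) : ℂ) ^ ν * sigma (-2 * ν) p.1) * ((√(quad M p.2.row) : ℝ) : ℂ) ^ (-ν) *
    besselK ν (2 * Real.pi * (p.1 : ℕ) * √(quad M p.2.row))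

variable {d : ℕ} {z : Matrix (Fin (d + 1 + 1)) (Fin (d + 1 + 1)) ℝ}

/-- With c = l · row, both the character and the Bessel argument depend on (j, l) only through m =
jl; only the power (j/l)^ν varies, and its sum over factorisations of m is a divisor sum. -/
theorem IsAffine.hasSum_besselCoeff (hd : 1 ≤ d) (hz : IsAffine z) (ν : ℂ) :
    HasSum (fun p : ℕ+ × Cosets d => besselCoeff (block z) ν p *
      cexp (2 * Real.pi * I * (((p.1 : ℕ) : ℝ) * pairing z p.2.row : ℝ)))
      (mellin (fun t => (remainder z t : ℂ)) (ν + 1 / 2)) := by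
  have h1 := hz.hasSum_mellin_remainder (ν + 1 / 2)
  have h2 := ((divisorEquiv (Cosets d)).trans
    (Equiv.prodCongr (vectorEquiv hd) (Equiv.refl ℕ+))).hasSum_iff.2 h1
  refine h2.sigma (fun p => ?_)
  obtain ⟨m, q⟩ := p
  set R := √(quad (block z) q.row) with hR
  have hR0 : 0 < R := Real.sqrt_pos.2 (quad_row_pos q hz.block_det_ne)
  have hfin := hasSum_fintype (fun x : Nat.divisorsAntidiagonal (m : ℕ) =>
    4 * (R : ℂ) ^ (-ν) * besselK ν (2 * Real.pi * (m : ℕ) * R) *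
      cexp (2 * Real.pi * I * (((m : ℕ) : ℝ) * pairing z q.row : ℝ)) *
        (((x.1.1 : ℝ) / (x.1.2 : ℝ) : ℝ) : ℂ) ^ ν)
  rw [← Finset.mul_sum, Finset.sum_coe_sort (m : ℕ).divisorsAntidiagonal
    (fun x => (((x.1 : ℝ) / (x.2 : ℝ) : ℝ) : ℂ) ^ ν),
    sum_divisorsAntidiagonal_div_cpow m.ne_zero] at hfin
  have hval : besselCoeff (block z) ν (m, q) *
      cexp (2 * Real.pi * I * (((m : ℕ) : ℝ) * pairing z q.row : ℝ)) =
      4 * (R : ℂ) ^ (-ν) * besselK ν (2 * Real.pi * (m : ℕ) * R) *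
      cexp (2 * Real.pi * I * (((m : ℕ) : ℝ) * pairing z q.row : ℝ)) *
        (((m : ℕ) : ℂ) ^ ν * sigma (-2 * ν) m) := by
    simp only [besselCoeff, ← hR]
    ring
  simp only at hval ⊢
  rw [hval]
  refine hfin.congr_fun fun x => ?_
  have hx := Nat.mem_divisorsAntidiagonal.1 x.2
  have hx1 : 0 < x.1.1 := Nat.pos_of_ne_zero fun h => hx.2 (by rw [← hx.1, h, zero_mul])
  have hx2 : 0 < x.1.2 := Nat.pos_of_ne_zero fun h => hx.2 (by rw [← hx.1, h, mul_zero])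
  have hx1' : (0 : ℝ) < x.1.1 := by exact_mod_cast hx1
  have hx2' : (0 : ℝ) < x.1.2 := by exact_mod_cast hx2
  have hmx : ((m : ℕ) : ℝ) = x.1.1 * x.1.2 := by exact_mod_cast hx.1.symm
  change 2 * (cexp (2 * Real.pi * I * ((x.1.1 : ℝ) * pairing z ((x.1.2 : ℤ) • q.row) : ℝ)) *
        (2 * (((x.1.1 : ℝ) / √(quad (block z) ((x.1.2 : ℤ) • q.row)) : ℝ) : ℂ) ^ (ν + 1 / 2 - 1 / 2) *
          besselK (ν + 1 / 2 - 1 / 2) (2 * Real.pi * ((x.1.1 : ℝ) * √(quad (block z) ((x.1.2 : ℤ) • q.row)))))) = _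
  rw [pairing_smul, quad_smul, Real.sqrt_mul (sq_nonneg _), Int.cast_natCast, Real.sqrt_sq hx2'.le,
    ← hR, add_sub_cancel_right, hmx]
  have e1 : (x.1.1 : ℝ) / (x.1.2 * R) = x.1.1 / x.1.2 * R⁻¹ := by field_simp
  rw [e1, ofReal_mul (_ / _), mul_cpow_ofReal_nonneg (by positivity) (by positivity), ofReal_inv R,
    inv_cpow _ _ (by rw [arg_ofReal_of_nonneg hR0.le]; exact Real.pi_pos.ne), ← cpow_neg,
    ← mul_assoc (x.1.1 : ℝ), ← mul_assoc (x.1.1 : ℝ), ← mul_assoc (2 * Real.pi)]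
  ring

/-- Convergence in ℂ is unconditional, hence absolute, and the characters have modulus 1. -/
theorem IsAffine.summable_norm_besselCoeff (hd : 1 ≤ d) (hz : IsAffine z) (ν : ℂ) :
    Summable fun p : ℕ+ × Cosets d => ‖besselCoeff (block z) ν p‖ := by
  refine ((hz.hasSum_besselCoeff hd ν).summable.norm).congr fun p => ?_
  rw [norm_mul, norm_cexp_two_pi_mul, mul_one]

end Reindex

/-! ### Fourier series on the torus -/

section Parseval

open ComplexConjugate

/-- The character `x ↦ exp(2πi h·x)`. -/
def character {k : ℕ} (h : Fin k → ℤ) (x : Fin k → ℝ) : ℂ :=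
  cexp (2 * Real.pi * I * (∑ i, (h i : ℝ) * x i : ℝ))

theorem norm_character {k : ℕ} (h : Fin k → ℤ) (x : Fin k → ℝ) : ‖character h x‖ = 1 :=
  norm_cexp_two_pi_mul _

theorem continuous_character {k : ℕ} (h : Fin k → ℤ) : Continuous (character h) := by
  unfold character
  fun_prop

theorem character_mul_conj {k : ℕ} (h h' : Fin k → ℤ) (x : Fin k → ℝ) :
    character h x * conj (character h' x) = character (h - h') x := by
  have : conj (character h' x) = character (-h') x := by
    rw [character, character, ← exp_conj]
    congr 1
    simp [map_ofNat]
  rw [this, character, character, character, ← Complex.exp_add, ← mul_add, ← ofReal_add,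
    ← Finset.sum_add_distrib]
  congr 4
  ext i
  simp
  ring

theorem integral_character {k : ℕ} (h : Fin k → ℤ) :
    ∫ x in Set.Icc (0 : Fin k → ℝ) 1, character h x = if h = 0 then 1 else 0 := by
  have h1 : ∀ n : ℤ, ∫ x : ℝ, (Set.Icc (0 : ℝ) 1).indicator (fun x => cexp (2 * Real.pi * I * n * x)) x =
      if n = 0 then 1 else 0 := by
    intro n
    rw [integral_indicator measurableSet_Icc, integral_Icc_eq_integral_Ioc,
      ← intervalIntegral.integral_of_le zero_le_one]
    split_ifs with hn
    · simp [hn]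
    · have hc : (2 * Real.pi * I * n : ℂ) ≠ 0 :=
        mul_ne_zero two_pi_I_ne_zero (by exact_mod_cast hn)
      rw [integral_exp_mul_complex hc]
      rw [ofReal_one, ofReal_zero, mul_one, mul_zero, mul_comm (2 * Real.pi * I : ℂ) n,
        Complex.exp_int_mul_two_pi_mul_I, Complex.exp_zero, sub_self, zero_div]
  have h2 : ∀ x : Fin k → ℝ, (Set.Icc (0 : Fin k → ℝ) 1).indicator (character h) x =
      ∏ i, (Set.Icc (0 : ℝ) 1).indicator (fun x => cexp (2 * Real.pi * I * h i * x)) (x i) := by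
    intro x
    by_cases hx : x ∈ Set.Icc (0 : Fin k → ℝ) 1
    · rw [Set.indicator_of_mem hx, character, ofReal_sum, Finset.mul_sum, Complex.exp_sum]
      refine Finset.prod_congr rfl fun i _ => ?_
      rw [Set.indicator_of_mem (show x i ∈ Set.Icc (0 : ℝ) 1 from ⟨hx.1 i, hx.2 i⟩)]
      congr 1; push_cast; ring
    · rw [Set.indicator_of_notMem hx]
      have : ∃ i, x i ∉ Set.Icc (0 : ℝ) 1 := by
        by_contra hcon
        push Not at hcon
        exact hx ⟨fun i => (hcon i).1, fun i => (hcon i).2⟩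
      obtain ⟨i, hi⟩ := this
      exact (Finset.prod_eq_zero (Finset.mem_univ i) (Set.indicator_of_notMem hi _)).symm
  rw [← integral_indicator measurableSet_Icc]
  simp_rw [h2]
  rw [integral_fintype_prod_volume_eq_prod (f := fun i (x : ℝ) =>
    (Set.Icc (0 : ℝ) 1).indicator (fun x => cexp (2 * Real.pi * I * h i * x)) x)]
  simp_rw [h1]
  split_ifs with h0
  · simp [h0]
  · obtain ⟨i, hi⟩ := Function.ne_iff.1 h0
    exact Finset.prod_eq_zero (Finset.mem_univ i) (if_neg hi)

variable {ι : Type*} {k : ℕ} {a : ι → ℂ} {φ : ι → Fin k → ℤ} {F : (Fin k → ℝ) → ℂ}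

theorem continuous_of_hasSum_character (ha : Summable fun i => ‖a i‖)
    (hF : ∀ x, HasSum (fun i => a i * character (φ i) x) (F x)) : Continuous F := by
  have : F = fun x => ∑' i, a i * character (φ i) x := funext fun x => (hF x).tsum_eq.symm
  rw [this]
  refine continuous_tsum (fun i => continuous_const.mul (continuous_character _)) ha fun i x => ?_
  rw [norm_mul, norm_character, mul_one]

theorem integrableOn_norm_sq_of_hasSum_character (ha : Summable fun i => ‖a i‖)
    (hF : ∀ x, HasSum (fun i => a i * character (φ i) x) (F x)) :
    IntegrableOn (fun x => ‖F x‖ ^ 2) (Set.Icc 0 1) :=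
  ((continuous_of_hasSum_character ha hF).norm.pow 2).integrableOn_Icc

/-- **Parseval's formula** for an absolutely convergent Fourier series on the torus. -/
theorem hasSum_norm_sq_of_hasSum_character [Countable ι] (hφ : Function.Injective φ)
    (ha : Summable fun i => ‖a i‖) (hF : ∀ x, HasSum (fun i => a i * character (φ i) x) (F x)) :
    HasSum (fun i => ‖a i‖ ^ 2) (∫ x in Set.Icc (0 : Fin k → ℝ) 1, ‖F x‖ ^ 2) := by
  classical
  have hmul : Summable fun p : ι × ι => ‖a p.1‖ * ‖a p.2‖ :=
    ha.mul_of_nonneg ha (fun _ => norm_nonneg _) fun _ => norm_nonneg _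
  have hpt : ∀ x, HasSum (fun p : ι × ι => a p.1 * conj (a p.2) * character (φ p.1 - φ p.2) x)
      ((‖F x‖ ^ 2 : ℝ) : ℂ) := by
    intro x
    have h1 := hF x
    have h2 : HasSum (fun i => conj (a i * character (φ i) x)) (conj (F x)) :=
      (hasSum_conj (f := fun i => a i * character (φ i) x)).2 (by simpa using h1)
    have h3 := h1.mul h2 (Summable.of_norm_bounded hmul fun p => by
      simp [norm_character])
    rw [mul_conj, normSq_eq_norm_sq] at h3
    refine h3.congr_fun fun p => ?_
    rw [← character_mul_conj, map_mul]
    ring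
  have hint := hasSum_integral_of_summable_integral_norm
    (μ := volume.restrict (Set.Icc (0 : Fin k → ℝ) 1))
    (F := fun (p : ι × ι) x => a p.1 * conj (a p.2) * character (φ p.1 - φ p.2) x)
    (fun p => (continuous_const.mul (continuous_character _)).integrableOn_Icc) (by
      refine hmul.congr fun p => ?_
      simp only [norm_mul, norm_character, mul_one, RCLike.norm_conj]
      rw [setIntegral_const]
      simp [Measure.real, Real.volume_Icc_pi])
  have hval : ∫ x in Set.Icc (0 : Fin k → ℝ) 1,
      ∑' p : ι × ι, a p.1 * conj (a p.2) * character (φ p.1 - φ p.2) x =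
      ((∫ x in Set.Icc (0 : Fin k → ℝ) 1, ‖F x‖ ^ 2 : ℝ) : ℂ) := by
    rw [← integral_complex_ofReal]
    exact integral_congr_ae (Filter.Eventually.of_forall fun x => (hpt x).tsum_eq)
  rw [hval] at hint
  -- By orthogonality and the injectivity of φ only the diagonal of the double series survives
  -- integration.
  have hdiag : Function.Injective fun i : ι => (i, i) := fun i j h => (Prod.ext_iff.1 h).1
  have h4 := (hdiag.hasSum_iff (fun p hp => by
    obtain ⟨i, j⟩ := p
    have hij : i ≠ j := fun h => hp ⟨i, by rw [h]⟩
    simp only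
    rw [integral_const_mul, integral_character, if_neg (sub_ne_zero.2 fun h => hij (hφ h)),
      mul_zero])).2 hint
  rw [← hasSum_ofReal]
  refine h4.congr_fun fun i => ?_
  simp only [Function.comp_apply]
  rw [integral_const_mul, integral_character, if_pos (sub_self _), mul_one, mul_conj,
    normSq_eq_norm_sq]

end Parseval

/-! ### Continuation of the split Mellin transform -/

section FourierExpansion

open ComplexConjugate

/-- The index `none` will carry the zero frequency, that is, the constant term. -/
theorem hasSum_option {α β : Type*} [AddCommMonoid α] [TopologicalSpace α] [ContinuousAdd α]
    {f : Option β → α} {a : α} (h : HasSum (fun b => f (some b)) a) : HasSum f (f none + a) := by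
  classical
  have h1 : HasSum (fun o : Option β => if o = none then f none else 0) (f none) :=
    hasSum_ite_eq none (f none)
  have h2 : HasSum (fun o : Option β => o.elim 0 fun b => f (some b)) a := by
    refine ((Option.some_injective β).hasSum_iff fun o ho => ?_).1 h
    cases o with
    | none => rfl
    | some b => exact absurd ⟨b, rfl⟩ ho
  refine (h1.add h2).congr_fun fun o => ?_
  cases o <;> simp

theorem ofReal_rpow_cpow {x : ℝ} (hx : 0 < x) (r : ℝ) (e : ℂ) :
    ((x ^ r : ℝ) : ℂ) ^ e = (x : ℂ) ^ (r * e) := by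
  rw [cpow_def_of_ne_zero (by exact_mod_cast (Real.rpow_pos_of_pos hx r).ne'),
    cpow_def_of_ne_zero (by exact_mod_cast hx.ne'), ← ofReal_log (Real.rpow_nonneg hx.le _),
    Real.log_rpow hx, ← ofReal_log hx.le]
  congr 1
  push_cast
  ring

variable {d : ℕ} {z : Matrix (Fin (d + 1 + 1)) (Fin (d + 1 + 1)) ℝ}

/-- The right-hand side is meromorphic everywhere and matches the series for Re s > 1. Its possible
singularities are ns = 0 and ns = 1, the zeros of ξ(ns), and s = 1, where the Levi term may have a
pole; all are excluded. -/
theorem IsAffine.E_eq (hz : IsAffine z) {Λ : ℂ → ℂ} (hmer : MeromorphicOn Λ Set.univ)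
    (han : ∀ w : ℂ, w ≠ 0 → w ≠ (d + 1) / 2 → AnalyticAt ℂ Λ w)
    (hmel : ∀ w : ℂ, ((d + 1) / 2 : ℝ) < w.re →
        HasMellin (fun t => ((theta (block z) t - 1 : ℝ) : ℂ)) w (Λ w)) {s : ℂ}
    (hs0 : (d + 2) * s ≠ 0) (hs1 : (d + 2) * s ≠ 1) (hs : s ≠ 1) (hxi : xi ((d + 2) * s) ≠ 0) :
    E (d + 1) z s = ((|z.det| : ℝ) : ℂ) ^ s *
      (2 * xi ((d + 2) * s) + Λ (((d + 2) * s - 1) / 2) +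
        mellin (fun t => (remainder z t : ℂ)) ((d + 2) * s / 2)) / xi ((d + 2) * s) := by
  have hD : 0 < |z.det| := abs_pos.2 hz.det_ne
  have hd0 : (d : ℂ) + 2 ≠ 0 := by exact_mod_cast (d + 1).succ_ne_zero
  have hB := hz.differentiable_mellin_remainder
  have hGa : ∀ s : ℂ, (d + 2) * s ≠ 0 → (d + 2) * s ≠ 1 → s ≠ 1 → xi ((d + 2) * s) ≠ 0 →
      AnalyticAt ℂ (fun s => ((|z.det| : ℝ) : ℂ) ^ s *
      (2 * xi ((d + 2) * s) + Λ (((d + 2) * s - 1) / 2) +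
        mellin (fun t => (remainder z t : ℂ)) ((d + 2) * s / 2)) / xi ((d + 2) * s)) s := by
    intro s h0 h1 hs1 hxi
    have a1 : AnalyticAt ℂ (fun s => Λ (((d + 2) * s - 1) / 2)) s := by
      refine AnalyticAt.fun_comp (han _ (div_ne_zero (sub_ne_zero.2 h1) two_ne_zero) fun h => hs1 ?_)
        (by fun_prop)
      have := (div_left_inj' two_ne_zero).1 h
      refine mul_left_cancel₀ hd0 ?_
      linear_combination this
    have a2 : AnalyticAt ℂ (fun s => xi ((d + 2) * s)) s :=
      AnalyticAt.fun_comp (analyticAt_xi h0 h1) (by fun_prop)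
    have a3 : AnalyticAt ℂ (fun s => mellin (fun t => (remainder z t : ℂ)) ((d + 2) * s / 2)) s :=
      AnalyticAt.fun_comp (hB.analyticAt _) (by fun_prop)
    exact ((analyticAt_ofReal_cpow hD analyticAt_id).mul
      (((analyticAt_const.mul a2).add a1).add a3)).div a2 hxi
  refine meromorphicContinuation_eq (G := fun s => ((|z.det| : ℝ) : ℂ) ^ s *
      (2 * xi ((d + 2) * s) + Λ (((d + 2) * s - 1) / 2) +
        mellin (fun t => (remainder z t : ℂ)) ((d + 2) * s / 2)) / xi ((d + 2) * s))
    ?_ ?_ ?_ (hGa s hs0 hs1 hs hxi)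
  · intro s _
    have a1 : MeromorphicAt (fun s => Λ (((d + 2) * s - 1) / 2)) s :=
      (hmer _ (Set.mem_univ _)).comp_analyticAt (f := Λ)
        (g := fun s => (((d : ℂ) + 2) * s - 1) / 2) (by fun_prop)
    have a2 : MeromorphicAt (fun s => xi ((d + 2) * s)) s :=
      (meromorphicOn_xi _ (Set.mem_univ _)).comp_analyticAt (f := xi)
        (g := fun s => ((d : ℂ) + 2) * s) (by fun_prop)
    have a3 : AnalyticAt ℂ (fun s => mellin (fun t => (remainder z t : ℂ)) ((d + 2) * s / 2)) s :=
      AnalyticAt.fun_comp (hB.analyticAt _) (by fun_prop)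
    exact ((analyticAt_ofReal_cpow hD analyticAt_id).meromorphicAt.mul
      (((analyticAt_const.meromorphicAt.mul a2).add a1).add a3.meromorphicAt)).div a2
  all_goals
    intro s hs
    have hre : (((d + 2) * s : ℂ)).re = (d + 2) * s.re := by
      rw [show ((d : ℂ) + 2) = ((d + 2 : ℝ) : ℂ) by push_cast; rfl, re_ofReal_mul]
    have hdn : (0 : ℝ) ≤ d := d.cast_nonneg
    have hre1 : (d : ℝ) + 2 < (((d + 2) * s : ℂ)).re := by rw [hre]; nlinarith
    have hxi' := xi_ne_zero_of_one_lt_re (s := (d + 2) * s) (by linarith)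
  · refine hGa s ?_ ?_ ?_ hxi'
    · intro h; rw [h] at hre1; simp at hre1; linarith
    · intro h; rw [h] at hre1; simp at hre1; linarith
    · rintro rfl; simp at hs
  · have key := eisensteinSeries_mul_xi (d := d + 1) (by omega) hz.det_ne hs
    rw [show (((d + 1 : ℕ) : ℂ) + 1) = d + 2 by push_cast; ring] at key
    rw [div_eq_iff hxi', key, hz.mellin_theta (L := Λ (((d + 2) * s - 1) / 2))]
    · rw [mul_div_cancel₀ _ (two_ne_zero' ℂ)]
    · rw [div_ofNat_re]; linarith
    · rw [show (d + 2) * s / 2 - 1 / 2 = ((d + 2) * s - 1) / 2 by ring]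
      refine hmel _ ?_
      rw [div_ofNat_re, sub_re, one_re]
      linarith

end FourierExpansion

/-! ### Iwasawa coordinates, the last column and the Levi block -/

section Coordinates

open Matrix

variable {d : ℕ}

theorem iwasawaMatrix_of_lt {x : Matrix (Fin (d + 1)) (Fin (d + 1)) ℝ} {y : Fin d → ℝ}
    {i j : Fin (d + 1)} (h : j < i) : iwasawaMatrix x y i j = 0 := by
  rw [iwasawaMatrix, mul_diagonal, of_apply, if_neg h.ne', if_neg h.not_gt, zero_mul]

theorem iwasawaMatrix_diag_ne_zero {x : Matrix (Fin (d + 1)) (Fin (d + 1)) ℝ} {y : Fin d → ℝ}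
    (hy : ∀ j, 0 < y j) (i : Fin (d + 1)) : iwasawaMatrix x y i i ≠ 0 := by
  rw [iwasawaMatrix, mul_diagonal, of_apply, if_pos rfl, one_mul]
  exact (Finset.prod_pos fun j _ => hy j).ne'

theorem iwasawaMatrix_castSucc_last (x : Matrix (Fin (d + 1)) (Fin (d + 1)) ℝ) (y : Fin d → ℝ)
    (i : Fin d) : iwasawaMatrix x y i.castSucc (Fin.last d) = x i.castSucc (Fin.last d) := by
  rw [iwasawaMatrix, mul_diagonal, of_apply, if_neg (Fin.castSucc_lt_last i).ne,
    if_pos (Fin.castSucc_lt_last i)]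
  simp [Finset.filter_false]

theorem det_block {k : ℕ} {z : Matrix (Fin (k + 1)) (Fin (k + 1)) ℝ}
    (hz : ∀ i j, j < i → z i j = 0) (hlast : z (Fin.last k) (Fin.last k) = 1) :
    (block z).det = z.det := by
  rw [det_of_isUpperTriangular (fun i j h => hz i j h),
    det_of_isUpperTriangular (M := block z) (fun i j h => hz _ _ (Fin.castSucc_lt_castSucc_iff.2 h)),
    Fin.prod_univ_castSucc, hlast, mul_one]
  rfl

theorem isAffine_iwasawaMatrix (x : Matrix (Fin (d + 1)) (Fin (d + 1)) ℝ) {y : Fin d → ℝ}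
    (hy : ∀ j, 0 < y j) : IsAffine (iwasawaMatrix x y) := by
  have h1 : iwasawaMatrix x y (Fin.last d) (Fin.last d) = 1 := by
    rw [iwasawaMatrix_last, if_pos rfl]
  have hdet : (iwasawaMatrix x y).det ≠ 0 :=
    det_ne_zero_of_upperTriangular (fun i j h => iwasawaMatrix_of_lt h)
      (iwasawaMatrix_diag_ne_zero hy)
  refine ⟨fun j => ?_, h1, hdet, ?_⟩
  · rw [iwasawaMatrix_last, if_neg (Fin.castSucc_lt_last j).ne]
  · rwa [det_block (fun i j h => iwasawaMatrix_of_lt h) h1]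

theorem block_setLastColumn (x : Matrix (Fin (d + 1)) (Fin (d + 1)) ℝ) (y : Fin d → ℝ)
    (t : Fin d → ℝ) : block (iwasawaMatrix (setLastColumn x t) y) = block (iwasawaMatrix x y) := by
  ext i j
  simp only [submatrix_apply, iwasawaMatrix, mul_diagonal, of_apply, setLastColumn,
    updateCol_ne (Fin.castSucc_lt_last j).ne]

theorem pairing_setLastColumn (x : Matrix (Fin (d + 1)) (Fin (d + 1)) ℝ) (y : Fin d → ℝ)
    (t : Fin d → ℝ) (c : Fin d → ℤ) :
    pairing (iwasawaMatrix (setLastColumn x t) y) c = ∑ i, (c i : ℝ) * t i := by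
  simp [pairing, iwasawaMatrix_castSucc_last, setLastColumn]

theorem detY_of_isAffine {z : Matrix (Fin (d + 1)) (Fin (d + 1)) ℝ} (hz : z.det ≠ 0)
    (hrow : ∀ j, z (Fin.last d) j = if j = Fin.last d then 1 else 0) : detY z = |z.det| := by
  rw [detY_eq _ hz]
  simp [hrow]

theorem embed_castSucc_castSucc (γ : Matrix (Fin (d + 1)) (Fin (d + 1)) ℝ) (i j : Fin (d + 1)) :
    embed γ i.castSucc j.castSucc = γ i j := by
  simp [embed]

theorem embed_castSucc_last (γ : Matrix (Fin (d + 1)) (Fin (d + 1)) ℝ) (i : Fin (d + 1)) :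
    embed γ i.castSucc (Fin.last (d + 1)) = 0 := by
  simp [embed]

theorem embed_last (γ : Matrix (Fin (d + 1)) (Fin (d + 1)) ℝ) (j : Fin (d + 1 + 1)) :
    embed γ (Fin.last (d + 1)) j = if j = Fin.last (d + 1) then 1 else 0 := by
  refine Fin.lastCases ?_ (fun j => ?_) j
  · simp [embed]
  · simp [embed, (Fin.castSucc_lt_last j).ne]

theorem det_embed (γ : Matrix (Fin (d + 1)) (Fin (d + 1)) ℝ) : (embed γ).det = γ.det := by
  rw [det_succ_row _ (Fin.last (d + 1)), Finset.sum_eq_single (Fin.last (d + 1))]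
  · rw [embed_last, if_pos rfl, mul_one, Even.neg_one_pow (by simp), one_mul]
    congr 1
    ext i j
    simp [embed_castSucc_castSucc]
  · intro j _ hj
    rw [embed_last, if_neg hj, mul_zero, zero_mul]
  · simp

theorem levi_embed_mul (γ : Matrix (Fin (d + 1)) (Fin (d + 1)) ℝ)
    (z : Matrix (Fin (d + 2)) (Fin (d + 2)) ℝ) : levi (embed γ * z) = γ * levi z := by
  ext i j
  simp [levi, mul_apply, Fin.sum_univ_castSucc, embed_castSucc_castSucc, embed_castSucc_last]

theorem embed_mul_last (γ : Matrix (Fin (d + 1)) (Fin (d + 1)) ℝ)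
    (z : Matrix (Fin (d + 2)) (Fin (d + 2)) ℝ) (j : Fin (d + 2)) :
    (embed γ * z) (Fin.last (d + 1)) j = z (Fin.last (d + 1)) j := by
  simp [mul_apply, embed_last]

/-- The quantity r(γz) is the length of the bottom row of γ · levi(z): the powers of the determinant
from ℓ and from the Levi part cancel. -/
theorem radius_embed_mul {z : Matrix (Fin (d + 2)) (Fin (d + 2)) ℝ}
    (hdet : z.det ≠ 0) (hlevi : (levi z).det = z.det)
    (hrow : ∀ j, z (Fin.last (d + 1)) j = if j = Fin.last (d + 1) then 1 else 0) (q : Cosets d) :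
    radius (embed q.rep * z) = √(quad (levi z) q.row) := by
  have hD : 0 < |z.det| := abs_pos.2 hdet
  have hldet : (levi z).det ≠ 0 := by rwa [hlevi]
  have hR : 0 < √(quad (levi z) q.row) := Real.sqrt_pos.2 (quad_row_pos q hldet)
  have hdete : (embed q.rep * z).det = z.det := by rw [det_mul, det_embed, q.det_rep, one_mul]
  have hd : (0 : ℝ) ≤ d := d.cast_nonneg
  rw [radius, ell, detY_of_isAffine (by rwa [hdete]) (fun j => by rw [embed_mul_last, hrow]), hdete,
    levi_embed_mul, detY_rep_mul q hldet, hlevi, ← Real.rpow_mul hD.le,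
    Real.div_rpow hD.le (by positivity), ← Real.rpow_natCast (√_), ← Real.rpow_mul hR.le]
  -- With n = d + 2 this is (-1/n) · (-n/(n-1)) = 1/(n-1).
  have e1 : -1 / (((d + 1 : ℕ) : ℝ) + 1) * (-((d : ℝ) + 2) / (d + 1)) = 1 / (d + 1) := by
    push_cast; field_simp; ring
  have e2 : ((d + 1 : ℕ) : ℝ) * (1 / (d + 1)) = 1 := by push_cast; field_simp
  rw [e1, e2, Real.rpow_one]
  have : 0 < |z.det| ^ (1 / ((d : ℝ) + 1)) := by positivity
  field_simp

end Coordinates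

/-! ### Squared moduli of the Bessel coefficients -/

section BesselTerm

open ComplexConjugate

theorem besselK_conj (ν : ℂ) (r : ℝ) : besselK (conj ν) r = conj (besselK ν r) := by
  rw [besselK, besselK, map_mul, ← integral_conj]
  congr 1
  · simp [map_ofNat]
  · refine setIntegral_congr_fun measurableSet_Ioi fun t ht => ?_
    simp only [map_mul, conj_ofReal]
    rw [conj_ofReal_cpow (le_of_lt ht), map_sub, map_one]

theorem sigma_conj (ν : ℂ) (m : ℕ) : sigma (conj ν) m = conj (sigma ν m) := by
  rw [sigma, sigma, map_sum]
  refine Finset.sum_congr rfl fun c _ => ?_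
  rw [← ofReal_natCast, conj_ofReal_cpow (Nat.cast_nonneg c)]

/-- All bases are positive reals, so conjugation only replaces ν by its conjugate; the exponents in
`besselTerm` are those of ν and of its conjugate, and 16 = 4². -/
theorem norm_sq_besselCoeff {d : ℕ} {M : Matrix (Fin (d + 1)) (Fin (d + 1)) ℝ} (hM : M.det ≠ 0)
    (a b : ℝ) {z : Matrix (Fin (d + 2)) (Fin (d + 2)) ℝ} (p : ℕ+ × Cosets d)
    (hr : radius (embed p.2.rep * z) = √(quad M p.2.row)) :
    ((‖besselCoeff M (((d + 2) * (a + b * I) - 1) / 2) p‖ ^ 2 : ℝ) : ℂ) =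
      16 * besselTerm a b p.1 (embed p.2.rep * z) := by
  set ν : ℂ := ((d + 2) * (a + b * I) - 1) / 2 with hν
  set R := √(quad M p.2.row) with hR
  have hR0 : 0 < R := Real.sqrt_pos.2 (quad_row_pos p.2 hM)
  have hm0 : (0 : ℝ) < (p.1 : ℕ) := by exact_mod_cast p.1.pos
  have hνc : conj ν = ((d + 2) * (a - b * I) - 1) / 2 := by
    rw [hν]
    simp only [map_div₀, map_sub, map_mul, map_add, conj_ofReal, conj_I, map_one, map_ofNat,
      map_natCast]
    ring
  have e1 : ((d : ℂ) + 2) * a - 1 = ν + conj ν := by rw [hνc, hν]; ring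
  have e2 : -((d : ℂ) + 2) * a + 1 - I * (d + 2) * b = -2 * ν := by rw [hν]; ring
  have e3 : -((d : ℂ) + 2) * a + 1 + I * (d + 2) * b = conj (-2 * ν) := by
    rw [map_mul, map_neg, map_ofNat, hνc]; ring
  have e4 : -((d : ℂ) + 2) * a + 1 = -ν + conj (-ν) := by rw [map_neg, hνc, hν]; ring
  have e5 : (((d : ℂ) + 2) * a - 1) / 2 + I * (d + 2) * b / 2 = ν := by rw [hν]; ring
  have e6 : (((d : ℂ) + 2) * a - 1) / 2 - I * (d + 2) * b / 2 = conj ν := by rw [hνc]; ring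
  rw [besselTerm]
  rw [hr, e5, e6, e1, e2, e3, e4, besselK_conj, sigma_conj,
    cpow_add _ _ (by exact_mod_cast hm0.ne' : ((p.1 : ℕ) : ℂ) ≠ 0),
    cpow_add _ _ (by exact_mod_cast hR0.ne' : (R : ℂ) ≠ 0), ← normSq_eq_norm_sq, ← mul_conj, besselCoeff,
    ← hR, ← ofReal_natCast, ← conj_ofReal_cpow hm0.le, ← conj_ofReal_cpow hR0.le]
  simp only [map_mul, map_ofNat]
  ring

end BesselTerm

/-! ### Fourier expansion in the last column and its mean square -/

section MeanSquare

open ComplexConjugate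

variable {d : ℕ}

/-- The constant term of `E (d + 1) z s` along the unipotent radical, where `D` is the determinant of
`z` and `M` is its Levi part. -/
def constantTerm (M : Matrix (Fin (d + 1)) (Fin (d + 1)) ℝ) (D : ℝ) (s : ℂ) : ℂ :=
  2 * (D : ℂ) ^ s + (D : ℂ) ^ ((1 - s) / (d + 1)) * (xi ((d + 2) * s - 1) / xi ((d + 2) * s)) *
    E d M (((d + 2) * s - 1) / (d + 1))

theorem natCast_add_one_mul_div (u : ℂ) : ((d : ℂ) + 1) * (u / (d + 1)) = u :=
  mul_div_cancel₀ _ (by exact_mod_cast d.succ_ne_zero)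

theorem div_natCast_add_one_ne_one {s : ℂ} (hs : s ≠ 1) : ((d + 2) * s - 1) / ((d : ℂ) + 1) ≠ 1 := by
  have hd : (d : ℂ) + 1 ≠ 0 := by exact_mod_cast d.succ_ne_zero
  have hd2 : (d : ℂ) + 2 ≠ 0 := by exact_mod_cast (d + 1).succ_ne_zero
  intro h
  rw [div_eq_one_iff_eq hd] at h
  exact hs (mul_left_cancel₀ hd2 (by linear_combination h))

/-- Both Λ and ξ commute with conjugation, and the determinant is real. This lets the cross terms be
written with values at the conjugate of s. -/
theorem conj_E (hd : 1 ≤ d) {M : Matrix (Fin (d + 1)) (Fin (d + 1)) ℝ}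
    (htri : ∀ i j, j < i → M i j = 0) (hdiag : ∀ i, M i i ≠ 0) {s : ℂ}
    (h0 : (d + 1) * s ≠ 0) (h1 : (d + 1) * s ≠ 1) (hs : s ≠ 1) (hxi : xi ((d + 1) * s) ≠ 0) :
    conj (E d M s) = E d M (conj s) := by
  obtain ⟨Λ, -, -, hconj, -, hE⟩ := exists_mellin_continuation_E hd htri hdiag
  have hc : ((d : ℂ) + 1) * conj s = conj ((d + 1) * s) := by simp
  rw [hE s h0 h1 hs hxi, hE (conj s) (by rw [hc]; simpa using h0)
    (by rw [hc]; exact fun h => h1 (by simpa using congrArg conj h))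
    (fun h => hs (by simpa using congrArg conj h))
    (by rw [hc, xi_conj]; simpa using hxi), hc, xi_conj, map_div₀, map_mul,
    conj_ofReal_cpow (abs_nonneg _), ← hconj, map_div₀, map_ofNat]

theorem hasSum_E_setLastColumn (hd : 1 ≤ d) (x : Matrix (Fin (d + 2)) (Fin (d + 2)) ℝ)
    {y : Fin (d + 1) → ℝ} (hy : ∀ j, 0 < y j) {D : ℝ} (hD : D = (iwasawaMatrix x y).det)
    (hD0 : 0 < D) {s : ℂ} (hs0 : (d + 2) * s ≠ 0) (hs1 : (d + 2) * s ≠ 1)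
    (hs2 : (d + 2) * s ≠ 2) (hs : s ≠ 1) (hxi : xi ((d + 2) * s) ≠ 0)
    (hxi' : xi ((d + 2) * s - 1) ≠ 0) (t : Fin (d + 1) → ℝ) :
    HasSum (fun o : Option (ℕ+ × Cosets d) =>
      o.elim (constantTerm (levi (iwasawaMatrix x y)) D s) (fun p => (D : ℂ) ^ s / xi ((d + 2) * s) *
        besselCoeff (levi (iwasawaMatrix x y)) (((d + 2) * s - 1) / 2) p) *
      character (o.elim 0 fun p => ((p.1 : ℕ) : ℤ) • p.2.row) t)
      (E (d + 1) (iwasawaMatrix (setLastColumn x t) y) s) := by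
  set zt := iwasawaMatrix (setLastColumn x t) y with hzt
  have hz := isAffine_iwasawaMatrix (setLastColumn x t) hy
  rw [← hzt] at hz
  set M := levi (iwasawaMatrix x y) with hM
  have hblock : block zt = M := block_setLastColumn x y t
  have htri : ∀ i j, j < i → M i j = 0 := fun i j h =>
    iwasawaMatrix_of_lt (Fin.castSucc_lt_castSucc_iff.2 h)
  have hdiag : ∀ i, M i i ≠ 0 := fun i => iwasawaMatrix_diag_ne_zero hy _
  have hdetM : M.det = D := by
    rw [hD]
    exact det_block (fun i j h => iwasawaMatrix_of_lt h) (by rw [iwasawaMatrix_last, if_pos rfl])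
  have hdetz : zt.det = D := by
    rw [hD, det_iwasawaMatrix, det_iwasawaMatrix]
  obtain ⟨Λ, hmer, han, -, hmel, hE⟩ := exists_mellin_continuation_E hd htri hdiag
  have hEz := hz.E_eq hmer han (by rw [hblock]; exact hmel) hs0 hs1 hs hxi
  have hEM := hE (((d + 2) * s - 1) / (d + 1))
    (by rw [natCast_add_one_mul_div]; exact sub_ne_zero.2 hs1)
    (by rw [natCast_add_one_mul_div]; exact fun h => hs2 (by linear_combination h))
    (div_natCast_add_one_ne_one hs) (by rw [natCast_add_one_mul_div]; exact hxi')
  rw [natCast_add_one_mul_div, hdetM, abs_of_pos hD0] at hEM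
  rw [hdetz, abs_of_pos hD0] at hEz
  have hDc : (D : ℂ) ≠ 0 := by exact_mod_cast hD0.ne'
  -- From s = (1-s)/(n-1) + (ns-1)/(n-1) with n = d + 2: the second power of D is absorbed by the
  -- Levi series, whose determinant is also D, and ξ(ns-1) cancels its denominator.
  have hconst : constantTerm M D s =
      (D : ℂ) ^ s * (2 * xi ((d + 2) * s) + Λ (((d + 2) * s - 1) / 2)) / xi ((d + 2) * s) := by
    have hpow : (D : ℂ) ^ s = (D : ℂ) ^ ((1 - s) / ((d : ℂ) + 1)) * (D : ℂ) ^ (((d + 2) * s - 1) / ((d : ℂ) + 1)) := by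
      rw [← cpow_add _ _ hDc]
      congr 1
      have hd1 : (d : ℂ) + 1 ≠ 0 := by exact_mod_cast d.succ_ne_zero
      field_simp
      ring
    have halg : ∀ {P Q X Y L : ℂ}, Q ≠ 0 → X ≠ 0 → Y ≠ 0 →
        2 * (P * Q) + P * (X / Y) * (Q * L / X) = P * Q * (2 * Y + L) / Y := by
      intro P Q X Y L hQ hX hY
      field_simp
    rw [constantTerm, hEM, hpow]
    exact halg (by simp [cpow_eq_zero_iff, hDc]) hxi' hxi
  have hsum := (hz.hasSum_besselCoeff hd (((d + 2) * s - 1) / 2)).mul_left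
    ((D : ℂ) ^ s / xi ((d + 2) * s))
  rw [show ((d + 2) * s - 1) / 2 + 1 / 2 = (d + 2) * s / 2 by ring, hblock] at hsum
  have hone : character (0 : Fin (d + 1) → ℤ) t = 1 := by simp [character]
  have hval : E (d + 1) zt s = constantTerm M D s * character (0 : Fin (d + 1) → ℤ) t +
      (D : ℂ) ^ s / xi ((d + 2) * s) *
        mellin (fun t => (remainder zt t : ℂ)) ((d + 2) * s / 2) := by
    rw [hEz, hconst, hone]
    ring
  rw [hval]
  refine hasSum_option (f := fun o : Option (ℕ+ × Cosets d) =>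
      o.elim (constantTerm M D s) (fun p => (D : ℂ) ^ s / xi ((d + 2) * s) *
        besselCoeff M (((d + 2) * s - 1) / 2) p) *
      character (o.elim 0 fun p => ((p.1 : ℕ) : ℤ) • p.2.row) t) (hsum.congr_fun fun p => ?_)
  have hp : ((p.1 : ℕ) : ℝ) * pairing zt p.2.row =
      ∑ i, (((((p.1 : ℕ) : ℤ) • p.2.row) i : ℤ) : ℝ) * t i := by
    rw [← pairing_setLastColumn x y t, pairing_smul]
    rfl
  simp only [Option.elim_some, character, ← hp]
  ring

theorem coefficient_index_injective : Function.Injective fun o : Option (ℕ+ × Cosets d) =>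
    (o.elim 0 fun p => ((p.1 : ℕ) : ℤ) • p.2.row : Fin (d + 1) → ℤ) := by
  have hne : ∀ p : ℕ+ × Cosets d, ((p.1 : ℕ) : ℤ) • p.2.row ≠ 0 := fun p =>
    smul_ne_zero (by exact_mod_cast p.1.ne_zero) p.2.row_ne_zero
  rintro (_ | p) (_ | p') h
  · rfl
  · exact absurd h.symm (hne p')
  · exact absurd h (hne p)
  · exact congrArg some (smul_row_injective h)

instance : Countable (Cosets d) := Cosets.row_injective.countable

/-- Parseval for the expansion of `hasSum_E_setLastColumn`; the index `none` contributes the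
constant term and the other indices the Bessel terms. -/
theorem mean_square_E (hd : 1 ≤ d) (x : Matrix (Fin (d + 2)) (Fin (d + 2)) ℝ)
    {y : Fin (d + 1) → ℝ} (hy : ∀ j, 0 < y j) {D : ℝ} (hD : D = (iwasawaMatrix x y).det)
    (hD0 : 0 < D) (a b : ℝ) {s : ℂ} (hsab : s = a + b * I) (hs0 : (d + 2) * s ≠ 0)
    (hs1 : (d + 2) * s ≠ 1) (hs2 : (d + 2) * s ≠ 2) (hs : s ≠ 1) (hxi : xi ((d + 2) * s) ≠ 0)
    (hxi' : xi ((d + 2) * s - 1) ≠ 0) :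
    IntegrableOn (fun t : Fin (d + 1) → ℝ => ‖E (d + 1) (iwasawaMatrix (setLastColumn x t) y) s‖ ^ 2)
      (Set.Icc 0 1) ∧
    Summable (fun p : ℕ+ × Cosets d => besselTerm a b (p.1 : ℕ) (embed p.2.rep * iwasawaMatrix x y)) ∧
    ((∫ t in Set.Icc (0 : Fin (d + 1) → ℝ) 1,
        ‖E (d + 1) (iwasawaMatrix (setLastColumn x t) y) s‖ ^ 2 : ℝ) : ℂ) =
      constantTerm (levi (iwasawaMatrix x y)) D s *
        conj (constantTerm (levi (iwasawaMatrix x y)) D s) +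
      16 * ((D : ℂ) ^ s / xi ((d + 2) * s) * conj ((D : ℂ) ^ s / xi ((d + 2) * s))) *
        ∑' m : ℕ+, ∑' γ : Cosets d,
          besselTerm a b (m : ℕ) (embed γ.rep * iwasawaMatrix x y) := by
  set z := iwasawaMatrix x y with hzdef
  have hz := isAffine_iwasawaMatrix x hy
  rw [← hzdef] at hz
  set M := levi z with hM
  set ν : ℂ := ((d + 2) * s - 1) / 2 with hν
  set C₀ : ℂ := (D : ℂ) ^ s / xi ((d + 2) * s) with hC₀
  have hdetM : M.det = z.det :=
    det_block (fun i j h => iwasawaMatrix_of_lt h) (by rw [hzdef, iwasawaMatrix_last, if_pos rfl])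
  have hF := hasSum_E_setLastColumn hd x hy hD hD0 hs0 hs1 hs2 hs hxi hxi'
  rw [← hzdef, ← hM, ← hν, ← hC₀] at hF
  have hsb : Summable fun p : ℕ+ × Cosets d => ‖besselCoeff M ν p‖ :=
    hz.summable_norm_besselCoeff hd ν
  have ha : Summable fun o : Option (ℕ+ × Cosets d) =>
      ‖(o.elim (constantTerm M D s) (fun p => C₀ * besselCoeff M ν p) : ℂ)‖ := by
    have h1 := (hsb.mul_left ‖C₀‖).hasSum
    refine (hasSum_option (f := fun o : Option (ℕ+ × Cosets d) =>
      ‖(o.elim (constantTerm M D s) (fun p => C₀ * besselCoeff M ν p) : ℂ)‖)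
      (h1.congr_fun fun p => ?_)).summable
    simp
  have hterm : ∀ p : ℕ+ × Cosets d, ((‖besselCoeff M ν p‖ ^ 2 : ℝ) : ℂ) =
      16 * besselTerm a b p.1 (embed p.2.rep * z) := by
    intro p
    have := norm_sq_besselCoeff (M := M) (by rw [hdetM]; exact hz.det_ne) a b p
      (radius_embed_mul hz.det_ne hdetM (fun j => iwasawaMatrix_last x y j) p.2)
    rwa [← hsab] at this
  -- The squares are the diagonal of the absolutely summable product family.
  have hsq : Summable fun p : ℕ+ × Cosets d => ‖besselCoeff M ν p‖ ^ 2 := by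
    refine ((hsb.mul_of_nonneg hsb (fun _ => norm_nonneg _) fun _ => norm_nonneg _).comp_injective
      (i := fun p : ℕ+ × Cosets d => (p, p)) fun p p' h => (Prod.ext_iff.1 h).1).congr fun p => ?_
    simp only [Function.comp_apply, pow_two]
  have hsummable : Summable fun p : ℕ+ × Cosets d => besselTerm a b (p.1 : ℕ) (embed p.2.rep * z) := by
    refine ((summable_ofReal.2 hsq).mul_left (1 / 16)).congr fun p => ?_
    rw [hterm p]
    ring
  refine ⟨integrableOn_norm_sq_of_hasSum_character ha hF, hsummable, ?_⟩
  have hpars := hasSum_norm_sq_of_hasSum_character coefficient_index_injective ha hF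
  have hsplit := hasSum_option (f := fun o : Option (ℕ+ × Cosets d) =>
      ‖(o.elim (constantTerm M D s) (fun p => C₀ * besselCoeff M ν p) : ℂ)‖ ^ 2)
      (a := ‖C₀‖ ^ 2 * ∑' p, ‖besselCoeff M ν p‖ ^ 2)
      ((hsq.hasSum.mul_left (‖C₀‖ ^ 2)).congr_fun fun p => by simp [mul_pow])
  rw [hpars.unique hsplit, mul_conj, mul_conj, normSq_eq_norm_sq, normSq_eq_norm_sq, ofReal_add,
    ofReal_mul, ofReal_tsum, ← hsummable.tsum_prod]
  simp only [hterm, tsum_mul_left, Option.elim_none]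
  ring

end MeanSquare

end DegenerateEisenstein

end

/-! ### The mean square formula -/

open DegenerateEisenstein in
theorem proposition3p5 (d n : ℕ) (hd : 1 ≤ d) (hn : n = d + 2)
    (x : Matrix (Fin (d + 2)) (Fin (d + 2)) ℝ) (y : Fin (d + 1) → ℝ) (hy : ∀ j, 0 < y j)
    (z : Matrix (Fin (d + 2)) (Fin (d + 2)) ℝ) (hz : z = iwasawaMatrix x y)
    (ℓ : ℝ) (hℓ : ℓ = ell z)
    (a b : ℝ) (s : ℂ) (hs : s = a + b * Complex.I)
    -- neither `ξ(ns)` nor `ξ(ns - 1)` has a pole or a zero, and `s` is not the pole `s = 1`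
    (hs0 : n * s ≠ 0) (hs1 : n * s ≠ 1) (hs2 : n * s ≠ 2) (hsn : s ≠ 1)
    (hxi : xi (n * s) ≠ 0) (hxi' : xi (n * s - 1) ≠ 0) :
    MeasureTheory.IntegrableOn
      (fun t : Fin (d + 1) → ℝ => ‖E (d + 1) (iwasawaMatrix (setLastColumn x t) y) s‖ ^ 2)
      (Set.Icc 0 1) ∧
    Summable (fun p : ℕ+ × Cosets d => besselTerm a b (p.1 : ℕ) (embed p.2.rep * z)) ∧
    ((∫ t in Set.Icc (0 : Fin (d + 1) → ℝ) 1,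
        ‖E (d + 1) (iwasawaMatrix (setLastColumn x t) y) s‖ ^ 2 : ℝ) : ℂ) =
      4 * (ℓ : ℂ) ^ (-2 * n * a : ℂ)
      + (‖xi (n * s - 1)‖ ^ 2 / ‖xi (n * s)‖ ^ 2 : ℝ)
        * ((∏ j : Fin (d + 1), y j ^ (d + 1 - (j : ℕ)) : ℝ) : ℂ) ^ ((2 - 2 * a) / (n - 1) : ℂ)
        * (‖E d (levi z) ((n * s - 1) / (n - 1))‖ ^ 2 : ℝ)
      + 2 * (ℓ : ℂ) ^ (-((n ^ 2 * a - 2 * n * a + n + Complex.I * n ^ 2 * b) / (n - 1)) : ℂ)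
        * (xi (n * (starRingEnd ℂ) s - 1) / xi (n * (starRingEnd ℂ) s))
        * E d (levi z) ((n * (starRingEnd ℂ) s - 1) / (n - 1))
      + 2 * (ℓ : ℂ) ^ (-((n ^ 2 * a - 2 * n * a + n - Complex.I * n ^ 2 * b) / (n - 1)) : ℂ)
        * (xi (n * s - 1) / xi (n * s))
        * E d (levi z) ((n * s - 1) / (n - 1))
      + 16 * (ℓ : ℂ) ^ (-2 * n * a : ℂ) / (‖xi (n * s)‖ ^ 2 : ℝ)
        * ∑' m : ℕ+, ∑' γ : Cosets d, besselTerm a b (m : ℕ) (embed γ.rep * z) := by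
  subst hz
  have hnc : (n : ℂ) = (d : ℂ) + 2 := by rw [hn]; push_cast; rfl
  rw [hnc] at hs0 hs1 hs2 hxi hxi'
  set D : ℝ := ∏ j : Fin (d + 1), y j ^ (d + 1 - (j : ℕ)) with hDdef
  have hD : D = (iwasawaMatrix x y).det := (det_iwasawaMatrix x y).symm
  have hD0 : 0 < D := Finset.prod_pos fun j _ => pow_pos (hy j) _
  have hDc : (D : ℂ) ≠ 0 := by exact_mod_cast hD0.ne'
  obtain ⟨h1, h2, h3⟩ := mean_square_E hd x hy hD hD0 a b hs hs0 hs1 hs2 hsn hxi hxi'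
  refine ⟨h1, h2, ?_⟩
  rw [h3]
  set M := levi (iwasawaMatrix x y) with hM
  set S := ∑' m : ℕ+, ∑' γ : Cosets d, besselTerm a b (m : ℕ) (embed γ.rep * iwasawaMatrix x y)
  have hd1 : (d : ℂ) + 1 ≠ 0 := by exact_mod_cast d.succ_ne_zero
  have hd2 : (d : ℂ) + 2 ≠ 0 := by exact_mod_cast (d + 1).succ_ne_zero
  -- Since ℓ = D^{-1/n}, all powers of ℓ become powers of D and can be compared.
  have hℓD : ∀ e : ℂ, (ℓ : ℂ) ^ e = (D : ℂ) ^ (-e / (d + 2)) := by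
    intro e
    rw [hℓ, ell, detY_of_isAffine (by rw [← hD]; exact hD0.ne') (fun j => iwasawaMatrix_last x y j),
      ← hD, abs_of_pos hD0, ofReal_rpow_cpow hD0]
    congr 1
    push_cast
    rw [show (d : ℂ) + 1 + 1 = d + 2 by ring]
    ring
  have hsc : (starRingEnd ℂ) s = a - b * Complex.I := by
    rw [hs, map_add, map_mul, Complex.conj_ofReal, Complex.conj_ofReal, Complex.conj_I]
    ring
  have hns : (starRingEnd ℂ) (((d : ℂ) + 2) * s) = (d + 2) * (starRingEnd ℂ) s := by
    simp [map_ofNat]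
  have hconjE : (starRingEnd ℂ) (E d M (((d + 2) * s - 1) / (d + 1))) =
      E d M (((d + 2) * (starRingEnd ℂ) s - 1) / (d + 1)) := by
    have htri : ∀ i j, j < i → M i j = 0 := fun i j h =>
      iwasawaMatrix_of_lt (Fin.castSucc_lt_castSucc_iff.2 h)
    have hdiag : ∀ i, M i i ≠ 0 := fun i => iwasawaMatrix_diag_ne_zero hy _
    rw [conj_E hd htri hdiag
      (by rw [natCast_add_one_mul_div]; exact sub_ne_zero.2 hs1)
      (by rw [natCast_add_one_mul_div]; exact fun h => hs2 (by linear_combination h))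
      (div_natCast_add_one_ne_one hsn) (by rw [natCast_add_one_mul_div]; exact hxi')]
    congr 1
    rw [map_div₀, map_sub, hns, map_one, map_add, map_natCast, map_one]
  have hconjexp : (starRingEnd ℂ) ((1 - s) / ((d : ℂ) + 1)) = (1 - (starRingEnd ℂ) s) / (d + 1) := by
    simp
  have hconjC : (starRingEnd ℂ) (constantTerm M D s) = 2 * (D : ℂ) ^ (starRingEnd ℂ) s +
      (D : ℂ) ^ ((1 - (starRingEnd ℂ) s) / ((d : ℂ) + 1)) *
        (xi ((d + 2) * (starRingEnd ℂ) s - 1) / xi ((d + 2) * (starRingEnd ℂ) s)) *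
        E d M (((d + 2) * (starRingEnd ℂ) s - 1) / (d + 1)) := by
    rw [constantTerm, map_add, map_mul, map_mul, map_mul, hconjE, conj_ofReal_cpow hD0.le,
      conj_ofReal_cpow hD0.le, hconjexp, map_div₀, ← xi_conj, ← xi_conj, map_sub, hns, map_one,
      map_ofNat]
  have hnorm : ∀ u : ℂ, ((‖u‖ ^ 2 : ℝ) : ℂ) = u * (starRingEnd ℂ) u := by
    intro u
    rw [Complex.mul_conj, Complex.normSq_eq_norm_sq]
  rw [hconjC, constantTerm, map_div₀, conj_ofReal_cpow hD0.le, ← xi_conj, hns, Complex.ofReal_div,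
    hnorm, hnorm, hnorm, ← xi_conj, ← xi_conj, map_sub, map_one, hnc,
    show (d : ℂ) + 2 - 1 = d + 1 by ring, hconjE, hns, hℓD, hℓD, hℓD]
  have p1 : (D : ℂ) ^ (-(-2 * ((d : ℂ) + 2) * a) / (d + 2)) = (D : ℂ) ^ s * (D : ℂ) ^ (starRingEnd ℂ) s := by
    rw [← Complex.cpow_add _ _ hDc, hsc, hs]
    congr 1
    field_simp
    ring
  have p2 : (D : ℂ) ^ ((2 - 2 * (a : ℂ)) / (d + 1)) = (D : ℂ) ^ ((1 - s) / ((d : ℂ) + 1)) *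
      (D : ℂ) ^ ((1 - (starRingEnd ℂ) s) / ((d : ℂ) + 1)) := by
    rw [← Complex.cpow_add _ _ hDc, hsc, hs]
    congr 1
    field_simp
    ring
  -- The cross exponent is s + (1 - s̄)/(n-1) = (na - 2a + 1 + inb)/(n-1); multiplied by -n it is
  -- the stated exponent of ℓ. The next identity is its conjugate.
  have p3 : (D : ℂ) ^ (-(-((((d : ℂ) + 2) ^ 2 * a - 2 * (d + 2) * a + (d + 2) +
      Complex.I * (d + 2) ^ 2 * b) / (d + 1))) / (d + 2)) =
      (D : ℂ) ^ s * (D : ℂ) ^ ((1 - (starRingEnd ℂ) s) / ((d : ℂ) + 1)) := by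
    rw [← Complex.cpow_add _ _ hDc, hsc, hs]
    congr 1
    field_simp
    ring
  have p4 : (D : ℂ) ^ (-(-((((d : ℂ) + 2) ^ 2 * a - 2 * (d + 2) * a + (d + 2) -
      Complex.I * (d + 2) ^ 2 * b) / (d + 1))) / (d + 2)) =
      (D : ℂ) ^ (starRingEnd ℂ) s * (D : ℂ) ^ ((1 - s) / ((d : ℂ) + 1)) := by
    rw [← Complex.cpow_add _ _ hDc, hsc, hs]
    congr 1
    field_simp
    ring
  rw [p1, p2, p3, p4]
  ring
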